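/- Let $G$ be a profinite group; subgroups are understood to be closed. For $x\in G$ let $|x|$ denote the order of $x$ as a supernatural (Steinitz) number, and write $[x,y]=x^{-1}y^{-1}xy$. The $\gamma_k^*$-values of $G$ ($k\ge 1$) are defined inductively: every element of $G$ is a $\gamma_1^*$-value; for $k\ge 2$, an element $a\in G$ is a $\gamma_k^*$-value if there exist $x,g\in G$ such that $a=[x,g]$, $(|x|,|g|)=1$, and $x$ is a power, in the profinite sense (that is, $x=y^{\lambda}$ with $\lambda\in\widehat{\mathbb Z}$), of some $\gamma_{k-1}^*$-value $y$. The nilpotent residual $\gamma_\infty(G)$ is the smallest normal subgroup $N$ of $G$ such that $G/N$ is pronilpotent. The group $G$ is meta-pronilpotent if it has a normal pronilpotent subgroup $N$ such that $G/N$ is pronilpotent. **Proposition.** Let $G$ be a meta-pronilpotent profinite group and let $k\ge 1$ be an integer. If the set of $\gamma_k^*$-values of $G$ has cardinality less than $2^{\aleph_0}$, then $\gamma_\infty(G)$ is finite. -/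

import Mathlib

/-- A Steinitz (supernatural) number `∏ p ^ n(p)`, given by its exponents `n(p) ∈ {0, 1, …, ∞}`. -/
abbrev SteinitzNumber : Type := Nat.Primes → ℕ∞

/-- Two Steinitz numbers are coprime if no prime divides both of them. -/
def SteinitzNumber.Coprime (a b : SteinitzNumber) : Prop :=
  ∀ p : Nat.Primes, a p = 0 ∨ b p = 0

section

variable (G : Type*) [Group G] [TopologicalSpace G]

/-- A profinite group is pronilpotent if all its quotients by open normal subgroups (which are
finite groups) are nilpotent, i.e. if it is an inverse limit of finite nilpotent groups. -/
def IsPronilpotent : Prop :=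
  ∀ U : OpenNormalSubgroup G, Group.IsNilpotent (G ⧸ U.toSubgroup)

/-- `G` has a closed normal pronilpotent subgroup `N` such that `G ⧸ N` is pronilpotent. -/
def IsMetaPronilpotent : Prop :=
  ∃ (N : Subgroup G) (_ : N.Normal),
    IsClosed (N : Set G) ∧ IsPronilpotent N ∧ IsPronilpotent (G ⧸ N)

/-- The nilpotent residual `γ_∞(G)`: the smallest closed normal subgroup with pronilpotent
quotient (see `isLeast_nilpotentResidual`). -/
def nilpotentResidual : Subgroup G :=
  sInf {N : Subgroup G | ∃ _ : N.Normal, IsClosed (N : Set G) ∧ IsPronilpotent (G ⧸ N)}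

variable {G}

/-- The order `|x|` of an element of a profinite group: the least common multiple, as a Steinitz
number, of the orders of the images of `x` in the quotients by open normal subgroups. -/
noncomputable def steinitzOrder (x : G) : SteinitzNumber := fun p =>
  ⨆ U : OpenNormalSubgroup G,
    (padicValNat (p : ℕ) (orderOf (QuotientGroup.mk x : G ⧸ U.toSubgroup)) : ℕ∞)

/-- The commutator `[x, y] = x⁻¹ y⁻¹ x y`. -/
def rightCommutator (x y : G) : G := x⁻¹ * y⁻¹ * x * y

/-- `y` is a power of `x` in the profinite sense: `y = x ^ l` for some `l` in the profinite
completion of `ℤ`. The set of these powers is the procyclic subgroup generated by `x`, that is,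
the closure of `{x ^ n | n ∈ ℤ}`. -/
def IsProfinitePower (y x : G) : Prop :=
  y ∈ closure (Subgroup.zpowers x : Set G)

variable (G)

/-- The set of `γ_k^*`-values of `G`, for `k ≥ 1` (the empty set is a dummy value at `k = 0`). -/
def gammaStarValues : ℕ → Set G
  | 0 => ∅
  | 1 => Set.univ
  | k + 2 => {a | ∃ x g : G, (∃ y ∈ gammaStarValues (k + 1), IsProfinitePower x y) ∧
      (steinitzOrder x).Coprime (steinitzOrder g) ∧ a = rightCommutator x g}

end

/-- `G ⧸ N` is pronilpotent iff `G ⧸ U` is nilpotent for all open normal subgroups `U ≥ N`. -/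
theorem isPronilpotent_quotient_iff {G : Type*} [Group G] [TopologicalSpace G]
    [IsTopologicalGroup G] (N : Subgroup G) [N.Normal] :
    IsPronilpotent (G ⧸ N) ↔
      ∀ U : OpenNormalSubgroup G, N ≤ U.toSubgroup → Group.IsNilpotent (G ⧸ U.toSubgroup) := by
  constructor
  · intro h U hNU
    let V : OpenNormalSubgroup (G ⧸ N) :=
      { toSubgroup := U.toSubgroup.map (QuotientGroup.mk' N)
        isOpen' := QuotientGroup.isOpenMap_coe _ U.isOpen'
        isNormal' := Subgroup.Normal.map inferInstance _ (QuotientGroup.mk'_surjective N) }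
    have := h V
    exact Group.nilpotent_of_mulEquiv
      (QuotientGroup.quotientQuotientEquivQuotient N U.toSubgroup hNU)
  · intro h V
    let U : OpenNormalSubgroup G :=
      { toSubgroup := V.toSubgroup.comap (QuotientGroup.mk' N)
        isOpen' := V.isOpen'.preimage QuotientGroup.continuous_mk
        isNormal' := inferInstance }
    have := h U (by
      intro x hx
      change (QuotientGroup.mk x : G ⧸ N) ∈ V.toSubgroup
      rw [(QuotientGroup.eq_one_iff x).2 hx]
      exact one_mem _)
    refine Group.nilpotent_of_surjective
      (QuotientGroup.map U.toSubgroup V.toSubgroup (QuotientGroup.mk' N) le_rfl) ?_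
    intro y
    obtain ⟨y, rfl⟩ := QuotientGroup.mk_surjective y
    obtain ⟨y, rfl⟩ := QuotientGroup.mk_surjective y
    exact ⟨QuotientGroup.mk y, rfl⟩

/-- In a profinite group the nilpotent residual is indeed the smallest closed normal subgroup with
pronilpotent quotient. -/
theorem isLeast_nilpotentResidual (G : Type*) [Group G] [TopologicalSpace G]
    [IsTopologicalGroup G] [CompactSpace G] [TotallyDisconnectedSpace G] :
    IsLeast {N : Subgroup G | ∃ _ : N.Normal, IsClosed (N : Set G) ∧ IsPronilpotent (G ⧸ N)}
      (nilpotentResidual G) := by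
  refine ⟨?_, fun N hN => sInf_le hN⟩
  have hn : (nilpotentResidual G).Normal := by
    refine ⟨fun x hx g => ?_⟩
    rw [nilpotentResidual, Subgroup.mem_sInf] at hx ⊢
    intro N hN
    exact hN.1.conj_mem x (hx N hN) g
  have hc : IsClosed (nilpotentResidual G : Set G) := by
    rw [nilpotentResidual, Subgroup.coe_sInf]
    exact isClosed_biInter fun N hN => hN.2.1
  refine ⟨hn, hc, (isPronilpotent_quotient_iff _).2 fun U hU => ?_⟩
  let I := {V : OpenNormalSubgroup G // Group.IsNilpotent (G ⧸ V.toSubgroup)}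
  have hclosed (V : OpenNormalSubgroup G) : IsClosed (V.toSubgroup : Set G) :=
    Subgroup.isClosed_of_isOpen _ V.isOpen'
  have hdir : Directed (· ⊇ ·) fun V : I => (V.1.toSubgroup : Set G) := by
    rintro ⟨V, hV⟩ ⟨W, hW⟩
    refine ⟨⟨V ⊓ W, ?_⟩, fun x hx => hx.1, fun x hx => hx.2⟩
    let f : G →* (G ⧸ V.toSubgroup) × (G ⧸ W.toSubgroup) :=
      (QuotientGroup.mk' V.toSubgroup).prod (QuotientGroup.mk' W.toSubgroup)
    have hf : f.ker = (V ⊓ W).toSubgroup := by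
      ext x
      rw [MonoidHom.mem_ker, Prod.ext_iff]
      exact and_congr (QuotientGroup.eq_one_iff x) (QuotientGroup.eq_one_iff x)
    have h1 : Group.IsNilpotent f.range := inferInstance
    exact Group.nilpotent_of_mulEquiv ((QuotientGroup.quotientKerEquivRange f).symm.trans
      (QuotientGroup.quotientMulEquivOfEq hf))
  have htop : Group.IsNilpotent (G ⧸ (⊤ : Subgroup G)) :=
    haveI := QuotientGroup.subsingleton_quotient_top (G := G)
    inferInstance
  have : Nonempty I :=
    ⟨⟨{ toSubgroup := ⊤, isOpen' := isOpen_univ, isNormal' := inferInstance }, htop⟩⟩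
  have hle : (⋂ V : I, (V.1.toSubgroup : Set G)) ⊆ U.toSubgroup := by
    intro x hx
    apply hU
    rw [nilpotentResidual, Subgroup.mem_sInf]
    rintro N ⟨hNn, hNc, hNp⟩
    by_contra hxN
    obtain ⟨W, hW⟩ := ProfiniteGrp.exist_openNormalSubgroup_sub_open_nhds_of_one
      (U := {y : G | x * y ∉ N})
      (hNc.isOpen_compl.preimage (continuous_const_mul x)) (by simpa using hxN)
    let V : OpenNormalSubgroup G :=
      { toSubgroup := N ⊔ W.toSubgroup
        isOpen' := Subgroup.isOpen_mono le_sup_right W.isOpen'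
        isNormal' := inferInstance }
    have hV := (isPronilpotent_quotient_iff N).1 hNp V le_sup_left
    have hxV : x ∈ N ⊔ W.toSubgroup := Set.mem_iInter.1 hx ⟨V, hV⟩
    obtain ⟨n, hn, w, hw, rfl⟩ := Subgroup.mem_sup_of_normal_left.1 hxV
    exact hW (inv_mem hw : w⁻¹ ∈ W.toSubgroup) (by simpa using hn)
  obtain ⟨V, hV⟩ : ∃ V : I, (V.1.toSubgroup : Set G) ⊆ U.toSubgroup := by
    have hK : IsCompact ((U.toSubgroup : Set G)ᶜ) :=
      (isClosed_compl_iff.2 U.isOpen').isCompact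
    obtain ⟨V, hV⟩ := hK.elim_directed_family_closed _ (fun V : I => hclosed V.1)
      (Set.disjoint_iff_inter_eq_empty.1 (Set.disjoint_compl_left_iff_subset.2 hle)) hdir
    exact ⟨V, Set.disjoint_compl_left_iff_subset.1 (Set.disjoint_iff_inter_eq_empty.2 hV)⟩
  have := V.2
  exact Group.nilpotent_of_surjective (QuotientGroup.map V.1.toSubgroup U.toSubgroup
    (MonoidHom.id G) hV) (QuotientGroup.map_surjective_of_surjective _ _ _
      (QuotientGroup.mk_surjective) _)

/-! Write K for the nilpotent residual; K is pronilpotent and so is G/K. Call [x, h] a coprime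
commutator if x ∈ K is a pro-π-element and h a pro-πᶜ-element for some set π of primes. The action
of h on the π-part of K is coprime, so [x, h] = [[y, h], h] for some pro-π-element y of K.
Iterating, every coprime commutator is a γ_k^*-value for every k ≥ 1
(`rightCommutator_mem_gammaStarValues`). Hence there are fewer than 2^ℵ₀ of them, and k plays no
further role.

A continuous map on a nonempty compact space with so few values is constant on a nonempty open set.
Applied to (x, h) ↦ [x, h], this gives for each π an open normal N such that every pro-πᶜ-element
centralizes the pro-π-elements of K ∩ N (`exists_forall_commute_proPiPart`). Using one well-chosen
infinite π, one sees that all but finitely many primes p satisfy this with N = G, so a single N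
serves all π = {p} (`exists_forall_prime_commute`).

Finally, coprime commutators generate K topologically. It follows that K ∩ N is central in K, so [K,
K] is finite by Schur's theorem. A coprime action on the abelian quotients of K has no nontrivial
fixed p-element, which puts K ∩ N inside [K, K]; hence K is finite
(`finite_of_forall_prime_commute`). -/

/-- An element is a `π`-element if all primes dividing its order belong to `π`. -/
def IsPiElement {Γ : Type*} [Group Γ] (π : Set ℕ) (x : Γ) : Prop :=
  ∀ p : ℕ, p.Prime → p ∣ orderOf x → p ∈ π

/-! ### Elements whose order involves only primes in π. -/

section PiElements

variable {Γ : Type*} [Group Γ] {π : Set ℕ}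

theorem IsPiElement.one : IsPiElement π (1 : Γ) := fun p hp h => by
  rw [orderOf_one] at h
  exact absurd (Nat.dvd_one.1 h) hp.ne_one

theorem IsPiElement.of_pow {x : Γ} {n : ℕ} (hn : ∀ p : ℕ, p.Prime → p ∣ n → p ∈ π)
    (h : x ^ n = 1) : IsPiElement π x :=
  fun p hp hpx => hn p hp (hpx.trans (orderOf_dvd_of_pow_eq_one h))

theorem IsPiElement.of_orderOf_dvd {Δ : Type*} [Group Δ] {x : Γ} {y : Δ} (hx : IsPiElement π x)
    (h : orderOf y ∣ orderOf x) : IsPiElement π y :=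
  fun p hp hpy => hx p hp (hpy.trans h)

theorem IsPiElement.map {Δ : Type*} [Group Δ] {x : Γ} (hx : IsPiElement π x) (f : Γ →* Δ) :
    IsPiElement π (f x) :=
  hx.of_orderOf_dvd (orderOf_map_dvd f x)

theorem isPiElement_map_iff {Δ : Type*} [Group Δ] {x : Γ} {f : Γ →* Δ}
    (hf : Function.Injective f) : IsPiElement π (f x) ↔ IsPiElement π x := by
  simp only [IsPiElement, orderOf_injective f hf]

theorem IsPiElement.zpow {x : Γ} (hx : IsPiElement π x) (n : ℤ) : IsPiElement π (x ^ n) :=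
  hx.of_orderOf_dvd (orderOf_dvd_of_mem_zpowers ⟨n, rfl⟩)

theorem IsPiElement.pow {x : Γ} (hx : IsPiElement π x) (n : ℕ) : IsPiElement π (x ^ n) :=
  hx.of_orderOf_dvd (orderOf_pow_dvd n)

theorem isPiElement_inv_iff {x : Γ} : IsPiElement π x⁻¹ ↔ IsPiElement π x := by
  simp only [IsPiElement, orderOf_inv]

theorem IsPiElement.conj {x : Γ} (hx : IsPiElement π x) (g : Γ) : IsPiElement π (g * x * g⁻¹) :=
  hx.map (MulAut.conj g).toMonoidHom

theorem IsPiElement.mono {π' : Set ℕ} {x : Γ} (hx : IsPiElement π x) (h : π ⊆ π') :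
    IsPiElement π' x := fun p hp hpx => h (hx p hp hpx)

theorem IsPiElement.coprime {Δ : Type*} [Group Δ] {x : Γ} {y : Δ} (hx : IsPiElement π x)
    (hy : IsPiElement πᶜ y) : (orderOf x).Coprime (orderOf y) :=
  Nat.Coprime.symm <| Nat.coprime_of_dvd fun p hp h1 h2 => hy p hp h1 (hx p hp h2)

theorem IsPiElement.eq_one {x : Γ} (hx : IsPiElement π x) (hx' : IsPiElement πᶜ x) : x = 1 := by
  have := hx.coprime hx'
  rwa [Nat.coprime_self, orderOf_eq_one_iff] at this

theorem Nat.exists_mul_of_set (π : Set ℕ) {n : ℕ} (hn : n ≠ 0) : ∃ a b : ℕ, n = a * b ∧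
    (∀ p : ℕ, p.Prime → p ∣ a → p ∈ π) ∧ (∀ p : ℕ, p.Prime → p ∣ b → p ∈ πᶜ) := by
  induction n using induction_on_primes with
  | zero => exact absurd rfl hn
  | one =>
    exact ⟨1, 1, rfl, fun p hp h => absurd (Nat.dvd_one.1 h) hp.ne_one,
      fun p hp h => absurd (Nat.dvd_one.1 h) hp.ne_one⟩
  | prime_mul q n hq ih =>
    obtain ⟨a, b, rfl, ha, hb⟩ := ih (right_ne_zero_of_mul hn)
    by_cases hqπ : q ∈ π
    · refine ⟨q * a, b, by ring, fun p hp h => ?_, hb⟩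
      rcases hp.dvd_mul.1 h with h | h
      · rwa [(Nat.prime_dvd_prime_iff_eq hp hq).1 h]
      · exact ha p hp h
    · refine ⟨a, q * b, by ring, ha, fun p hp h => ?_⟩
      rcases hp.dvd_mul.1 h with h | h
      · rwa [(Nat.prime_dvd_prime_iff_eq hp hq).1 h]
      · exact hb p hp h

/-- Split the order as ab with a a π-number and b a πᶜ-number. A Bézout relation ua + vb = 1 gives
the exponent e = vb. -/
theorem exists_zpow_isPiElement (π : Set ℕ) {x : Γ} (hx : IsOfFinOrder x) :
    ∃ e : ℤ, IsPiElement π (x ^ e) ∧ IsPiElement πᶜ (x ^ (1 - e)) := by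
  obtain ⟨a, b, hab, ha, hb⟩ := Nat.exists_mul_of_set π hx.orderOf_pos.ne'
  have hcop : Nat.Coprime a b := Nat.coprime_of_dvd fun p hp h1 h2 => hb p hp h2 (ha p hp h1)
  obtain ⟨u, v, huv⟩ := Nat.isCoprime_iff_coprime.2 hcop
  have key (m : ℤ) : x ^ (m * (a * b)) = 1 := by
    rw [mul_comm, zpow_mul]
    have : x ^ ((a : ℤ) * b) = 1 := by
      rw [← Nat.cast_mul, ← hab, zpow_natCast, pow_orderOf_eq_one]
    rw [this, one_zpow]
  refine ⟨v * b, IsPiElement.of_pow ha ?_, IsPiElement.of_pow hb ?_⟩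
  · rw [← zpow_natCast, ← zpow_mul, ← key v]
    congr 1
    ring
  · rw [← zpow_natCast, ← zpow_mul, ← key u]
    congr 1
    rw [← huv]
    ring

/-- An element of finite order lies in every subgroup containing its primary parts. -/
theorem mem_of_primary_mem {x : Γ} (hx : IsOfFinOrder x) (S : Subgroup Γ)
    (h : ∀ q : ℕ, q.Prime → ∀ m : ℕ, IsPiElement {q} (x ^ m) → x ^ m ∈ S) : x ∈ S := by
  have hn := hx.orderOf_pos.ne'
  -- The exponents m with x ^ m ∈ S form kℤ. If a prime q divided k, it would divide the q'-part of
  -- the order of x, since raising x to that part gives a q-element.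
  obtain ⟨k, hk⟩ : ∃ k : ℤ, (S.comap (zpowersHom Γ x)).toAddSubgroup' = AddSubgroup.zmultiples k := by
    obtain ⟨k, hk⟩ := Int.subgroup_cyclic (S.comap (zpowersHom Γ x)).toAddSubgroup'
    exact ⟨k, by rw [hk, AddSubgroup.zmultiples_eq_closure]⟩
  have hmem (m : ℤ) : x ^ m ∈ S ↔ k ∣ m := by
    rw [← Int.mem_zmultiples_iff, ← hk]
    rfl
  have h1 : IsUnit k := by
    rw [Int.isUnit_iff_natAbs_eq]
    by_contra hne
    obtain ⟨q, hq, hqk⟩ := Nat.exists_prime_and_dvd hne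
    have hqk' : (q : ℤ) ∣ k := Int.natCast_dvd.2 hqk
    have h2 : k ∣ (orderOf x : ℤ) := (hmem _).1 (by simp [pow_orderOf_eq_one])
    have h3 := h q hq (ordCompl[q] (orderOf x)) (IsPiElement.of_pow
      (n := ordProj[q] (orderOf x)) (fun p hp hpd => ?_) ?_)
    · rw [← zpow_natCast, hmem] at h3
      exact Nat.not_dvd_ordCompl hq hn (Int.natCast_dvd_natCast.1 (hqk'.trans h3))
    · exact (Nat.prime_dvd_prime_iff_eq hp hq).1 (hp.dvd_of_dvd_pow hpd)
    · rw [← pow_mul, mul_comm, Nat.ordProj_mul_ordCompl_eq_self, pow_orderOf_eq_one]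
  simpa using (hmem 1).2 h1.dvd

end PiElements

universe u

/-! ### Coprime elements in finite nilpotent groups, and a nilpotency criterion. -/

section FiniteNilpotent

variable {Γ : Type u} [Group Γ] [Finite Γ] {π : Set ℕ}

/-- A finite nilpotent group has a separating family of endomorphisms onto subgroups of prime
power order. -/
theorem Group.IsNilpotent.exists_primary_coordinates (Γ : Type u) [Group Γ] [Finite Γ]
    [Group.IsNilpotent Γ] : ∃ (ι : Type u) (p : ι → ℕ) (f : ι → Γ →* Γ),
      (∀ i x, IsPiElement {p i} (f i x)) ∧ ∀ x : Γ, (∀ i, f i x = 1) → x = 1 := by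
  obtain ⟨e⟩ := ((Group.isNilpotent_of_finite_tfae (G := Γ)).out 0 4).1 ‹_›
  refine ⟨Σ p : (Nat.card Γ).primeFactors, Sylow p Γ, fun i => i.1,
    fun i => (i.2 : Subgroup Γ).subtype.comp (((Pi.evalMonoidHom _ i.2).comp
      (Pi.evalMonoidHom _ i.1)).comp e.symm.toMonoidHom), ?_, ?_⟩
  · rintro ⟨⟨p, hp⟩, P⟩ x
    suffices h : IsPiElement {p} (e.symm x ⟨p, hp⟩ P) from h.map (P : Subgroup Γ).subtype
    intro q hq hqa
    have : Fact p.Prime := ⟨Nat.prime_of_mem_primeFactors hp⟩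
    obtain ⟨k, hk⟩ := IsPGroup.iff_orderOf.1 P.isPGroup' (e.symm x ⟨p, hp⟩ P)
    rw [hk] at hqa
    exact (Nat.prime_dvd_prime_iff_eq hq this.out).1 (hq.dvd_of_dvd_pow hqa)
  · intro x hx
    refine e.symm.injective ?_
    ext p P
    simpa using hx ⟨p, P⟩

/-- With this criterion, statements about π-elements can be checked one coordinate at a time. -/
theorem isPiElement_iff_coordinates {ι : Type*} {p : ι → ℕ} {f : ι → Γ →* Γ}
    (hA : ∀ i x, IsPiElement {p i} (f i x)) (hf : ∀ x : Γ, (∀ i, f i x = 1) → x = 1) {x : Γ} :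
    IsPiElement π x ↔ ∀ i, p i ∉ π → f i x = 1 := by
  constructor
  · intro hx i hi
    exact (hx.map (f i)).eq_one ((hA i _).mono (by simpa using hi))
  · intro hx
    obtain ⟨e, he, he'⟩ := exists_zpow_isPiElement π (isOfFinOrder_of_finite x)
    have h1 : x ^ (1 - e) = 1 := by
      refine hf _ fun i => ?_
      by_cases hi : p i ∈ π
      · refine ((hA i _).mono ?_).eq_one (he'.map (f i))
        simpa using hi
      · rw [map_zpow, hx i hi, one_zpow]
    rw [zpow_sub, zpow_one, mul_inv_eq_one] at h1
    rwa [h1]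

theorem IsPiElement.mul [Group.IsNilpotent Γ] {x y : Γ} (hx : IsPiElement π x)
    (hy : IsPiElement π y) : IsPiElement π (x * y) := by
  obtain ⟨ι, p, f, hA, hf⟩ := Group.IsNilpotent.exists_primary_coordinates Γ
  rw [isPiElement_iff_coordinates hA hf] at *
  intro i hi
  rw [map_mul, hx i hi, hy i hi, one_mul]

theorem IsPiElement.commute [Group.IsNilpotent Γ] {x y : Γ} (hx : IsPiElement π x)
    (hy : IsPiElement πᶜ y) : Commute x y := by
  obtain ⟨ι, p, f, hA, hf⟩ := Group.IsNilpotent.exists_primary_coordinates Γ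
  rw [isPiElement_iff_coordinates hA hf] at *
  rw [← commutatorElement_eq_one_iff_commute]
  refine hf _ fun i => ?_
  rw [map_commutatorElement]
  by_cases hi : p i ∈ π
  · rw [hy i (by simpa using hi), commutatorElement_one_right]
  · rw [hx i hi, commutatorElement_one_left]

/-- The `π`-elements of a nilpotent subgroup of a finite group form a subgroup. -/
def piSubgroup (π : Set ℕ) (K : Subgroup Γ) [Group.IsNilpotent K] : Subgroup Γ where
  carrier := {x | x ∈ K ∧ IsPiElement π x}
  one_mem' := ⟨one_mem _, IsPiElement.one⟩
  mul_mem' := by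
    rintro x y ⟨hxK, hx⟩ ⟨hyK, hy⟩
    refine ⟨mul_mem hxK hyK, ?_⟩
    have hx' : IsPiElement π (⟨x, hxK⟩ : K) := (isPiElement_map_iff K.subtype_injective).1 hx
    have hy' : IsPiElement π (⟨y, hyK⟩ : K) := (isPiElement_map_iff K.subtype_injective).1 hy
    exact (hx'.mul hy').map K.subtype
  inv_mem' := by
    rintro x ⟨hxK, hx⟩
    exact ⟨inv_mem hxK, isPiElement_inv_iff.2 hx⟩

instance piSubgroup_normal {K : Subgroup Γ} [Group.IsNilpotent K] [K.Normal] :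
    (piSubgroup π K).Normal :=
  ⟨fun x hx g => ⟨Subgroup.Normal.conj_mem inferInstance x hx.1 g, hx.2.conj g⟩⟩

/-- If `s` is a `π`-element, `t` a `πᶜ`-element and `[s, t]` lies in a nilpotent normal
subgroup whose elements commute with all elements of coprime order, then `[s, t]` is a
`π`-element. -/
theorem isPiElement_rightCommutator {K : Subgroup Γ} [K.Normal] [Group.IsNilpotent K]
    {s t : Γ} (h : ∀ x ∈ K, IsPiElement πᶜ x → Commute x s)
    (hs : IsPiElement π s) (hK : rightCommutator s t ∈ K) :
    IsPiElement π (rightCommutator s t) := by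
  set c := rightCommutator s t with hc
  obtain ⟨e, he, he'⟩ := exists_zpow_isPiElement π (isOfFinOrder_of_finite c)
  set b := c ^ (1 - e) with hb
  have hce : c = c ^ e * b := by rw [hb, ← zpow_add]; simp
  have hbs : Commute b s := h b (zpow_mem hK _) he'
  let P := piSubgroup π K
  have ha : c ^ e ∈ P := ⟨zpow_mem hK _, he⟩
  have hst : t⁻¹ * s * t = s * c := by rw [hc, rightCommutator]; group
  let f := QuotientGroup.mk' P
  -- Modulo the π-part of K, the conjugate of s is s * b with commuting factors. Raising it to the
  -- power `orderOf s` therefore kills the πᶜ-element b.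
  have h1 : f (t⁻¹ * s * t) = f s * f b := by
    have h0 : f (c ^ e) = 1 := (QuotientGroup.eq_one_iff _).2 ha
    rw [hst, hce, map_mul, map_mul, h0, one_mul]
  have h2 : (t⁻¹ * s * t) ^ orderOf s = 1 := by
    have := (conj_pow (i := orderOf s) (a := t⁻¹) (b := s))
    rw [inv_inv] at this
    rw [this, pow_orderOf_eq_one]
    group
  have h3 : f (b ^ orderOf s) = 1 := by
    have := congrArg f h2
    rwa [map_pow, h1, ((hbs.symm).map f).mul_pow, ← map_pow, pow_orderOf_eq_one, map_one, one_mul,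
      ← map_pow] at this
  have h4 : b ^ orderOf s ∈ P := (QuotientGroup.eq_one_iff _).1 h3
  have h5 : b ^ orderOf s = 1 := h4.2.eq_one (he'.pow _)
  have h6 : b = 1 := (he'.of_orderOf_dvd dvd_rfl : IsPiElement πᶜ b).eq_one
    (IsPiElement.of_pow (fun p hp hd => by rw [compl_compl]; exact hs p hp hd) h5)
  rw [hce, h6, mul_one]
  exact he

/-- A finite group with a nilpotent normal subgroup `K` is nilpotent if the elements of `K`
commute with all elements of coprime order and `K` contains all coprime commutators. -/
theorem isNilpotent_of_coprime_commute (K : Subgroup Γ) [K.Normal] [Group.IsNilpotent K]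
    (h : ∀ (π : Set ℕ) (x g : Γ), x ∈ K → IsPiElement π x → IsPiElement πᶜ g → Commute x g)
    (hK : ∀ (π : Set ℕ) (x g : Γ), IsPiElement π x → IsPiElement πᶜ g →
      rightCommutator x g ∈ K) : Group.IsNilpotent Γ := by
  have hcomm (π : Set ℕ) (s t : Γ) (hs : IsPiElement π s) (ht : IsPiElement πᶜ t) :
      Commute s t := by
    have h1 : IsPiElement π (rightCommutator s t) := isPiElement_rightCommutator
      (fun x hxK hx => h _ x s hxK hx (by rwa [compl_compl])) hs (hK π s t hs ht)
    have h2 : IsPiElement πᶜ (rightCommutator t s) := isPiElement_rightCommutator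
      (fun x hxK hx => h _ x t hxK hx (by rwa [compl_compl])) ht (hK _ t s ht (by rwa [compl_compl]))
    have h3 : rightCommutator t s = (rightCommutator s t)⁻¹ := by
      simp only [rightCommutator]; group
    rw [h3, isPiElement_inv_iff] at h2
    have h4 := h1.eq_one h2
    rw [rightCommutator, mul_assoc, ← mul_inv_rev, inv_mul_eq_one] at h4
    exact h4.symm
  refine (Group.isNilpotent_of_finite_tfae (G := Γ)).out 0 3 |>.2 fun p hp P => ?_
  have hpP (q : ℕ) (hq : q.Prime) (Q : Sylow q Γ) (x : Γ) (hx : x ∈ Q) : IsPiElement {q} x := by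
    have : Fact q.Prime := ⟨hq⟩
    obtain ⟨k, hk⟩ := IsPGroup.iff_orderOf.1 Q.isPGroup' ⟨x, hx⟩
    rw [Subgroup.orderOf_mk] at hk
    intro r hr hrx
    rw [hk] at hrx
    exact (Nat.prime_dvd_prime_iff_eq hr hq).1 (hr.dvd_of_dvd_pow hrx)
  rw [← Subgroup.normalizer_eq_top_iff]
  by_contra hne
  have hidx : (Subgroup.normalizer ((P : Subgroup Γ) : Set Γ)).index ≠ 1 :=
    fun h => hne (Subgroup.index_eq_one.1 h)
  -- If the normalizer of P is proper, take a prime q dividing its index. Some Sylow q-subgroup lies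
  -- in the normalizer: P itself if q = p, any one centralizing P otherwise. Then q cannot divide
  -- the index.
  obtain ⟨q, hq, hqi⟩ := Nat.exists_prime_and_dvd hidx
  have : Fact q.Prime := ⟨hq⟩
  obtain ⟨Q⟩ : Nonempty (Sylow q Γ) := inferInstance
  have hle : ∃ Q : Sylow q Γ, (Q : Subgroup Γ) ≤ Subgroup.normalizer ((P : Subgroup Γ) : Set Γ) := by
    by_cases hpq : q = p
    · subst hpq
      exact ⟨P, Subgroup.le_normalizer⟩
    · refine ⟨Q, fun x hx => ?_⟩
      rw [Subgroup.mem_normalizer_iff]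
      have hc (y : Γ) (hy : y ∈ P) : Commute y x :=
        hcomm {p} y x (hpP p hp.out P y hy) ((hpP q hq Q x hx).mono (by simpa using Ne.symm hpq))
      intro y
      refine ⟨fun hy => ?_, fun hy => ?_⟩
      · rw [← (hc y hy).eq, mul_inv_cancel_right]
        exact hy
      · have := hc _ hy
        have h5 : y = x * y * x⁻¹ := by
          have h6 := this.eq
          rw [inv_mul_cancel_right] at h6
          exact mul_left_cancel h6
        rwa [h5]
  obtain ⟨Q, hQ⟩ := hle
  exact Q.not_dvd_index (hqi.trans (Subgroup.index_dvd_of_le hQ))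

end FiniteNilpotent

/-! ### Coprime actions on nilpotent and abelian groups. -/

section CoprimeAction

/-- In a nilpotent group with an automorphism `α` of order coprime to all orders of elements, two
elements of the form `x⁻¹ * α x` coincide if they differ by an element fixed by `α`. -/
theorem Group.IsNilpotent.inv_mul_apply_eq_of_fixed (P : Type*) [Group P] [Group.IsNilpotent P] :
    ∀ (α : P ≃* P) (n : ℕ), (∀ x, α^[n] x = x) → (∀ x : P, (orderOf x).Coprime n) →
      ∀ x y : P, α (x⁻¹ * α x * (y⁻¹ * α y)⁻¹) = x⁻¹ * α x * (y⁻¹ * α y)⁻¹ →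
        x⁻¹ * α x * (y⁻¹ * α y)⁻¹ = 1 := by
  refine Group.nilpotent_center_quotient_ind (P := fun P _ _ => ∀ (α : P ≃* P) (n : ℕ),
    (∀ x, α^[n] x = x) → (∀ x : P, (orderOf x).Coprime n) →
      ∀ x y : P, α (x⁻¹ * α x * (y⁻¹ * α y)⁻¹) = x⁻¹ * α x * (y⁻¹ * α y)⁻¹ →
        x⁻¹ * α x * (y⁻¹ * α y)⁻¹ = 1) P (fun _ _ _ _ _ _ _ _ _ _ => Subsingleton.elim _ _) ?_
  intro P _ _ ih α n hα hn x y hc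
  set c := x⁻¹ * α x * (y⁻¹ * α y)⁻¹ with hcdef
  let f := QuotientGroup.mk' (Subgroup.center P)
  let β : P ⧸ Subgroup.center P ≃* P ⧸ Subgroup.center P :=
    QuotientGroup.congr (Subgroup.center P) (Subgroup.center P) α
      (Subgroup.characteristic_iff_map_eq.1 inferInstance α)
  have hβ (z : P) : β (f z) = f (α z) := rfl
  have hβn (m : ℕ) (z : P) : β^[m] (f z) = f (α^[m] z) :=
    ((Function.Semiconj.iterate_right (f := f) (ga := α) (gb := β) (fun z => (hβ z).symm) m) z).symm
  have hfc : f c = (f x)⁻¹ * β (f x) * ((f y)⁻¹ * β (f y))⁻¹ := by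
    simp only [hβ, ← map_inv, ← map_mul, hcdef]
  have h1 : f c = 1 := by
    rw [hfc]
    refine ih β n (fun z => ?_) (fun z => ?_) _ _ ?_
    · obtain ⟨z, rfl⟩ := QuotientGroup.mk'_surjective _ z
      exact (hβn n z).trans (by rw [hα])
    · obtain ⟨z, rfl⟩ := QuotientGroup.mk'_surjective _ z
      exact Nat.Coprime.coprime_dvd_left (orderOf_map_dvd _ z) (hn z)
    · rw [← hfc, hβ, hc]
  have hz : c ∈ Subgroup.center P := (QuotientGroup.eq_one_iff _).1 h1
  have hz' (z : P) : z * c = c * z := Subgroup.mem_center_iff.1 hz z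
  have hcx : α x = x * c * y⁻¹ * α y := by rw [hcdef]; group
  -- By induction on the central quotient, c is central, and α fixes it, so the relation α x = x c
  -- y⁻¹ α y telescopes. At m = n it yields c ^ n = 1, and coprimality gives c = 1.
  have key (m : ℕ) : α^[m] x = x * c ^ m * y⁻¹ * α^[m] y := by
    induction m with
    | zero => simp
    | succ m ihm =>
      rw [Function.iterate_succ_apply', ihm, Function.iterate_succ_apply', map_mul, map_mul,
        map_mul, map_pow, hc, map_inv, hcx, pow_succ']
      have hcm : ∀ z, c ^ m * z = z * c ^ m := fun z =>
          ((show Commute c z from (hz' z).symm).pow_left m).eq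
      congr 1
      simp only [mul_assoc]
      rw [← mul_assoc (α y), ← hcm (α y), mul_assoc (c ^ m), mul_inv_cancel, mul_one, hcm]
  have h2 : c ^ n = 1 := by
    have := key n
    rw [hα, hα, inv_mul_cancel_right] at this
    exact left_eq_mul.1 this
  have h3 := hn c
  rw [Nat.coprime_iff_gcd_eq_one, Nat.gcd_eq_left (orderOf_dvd_of_pow_eq_one h2)] at h3
  exact orderOf_eq_one_iff.1 h3

/-- If f x = x⁻¹ * α x agrees at two points of its own range, their quotient is fixed by α. So f is
injective on its range, hence by finiteness maps it onto itself. -/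
theorem Group.IsNilpotent.exists_inv_mul_apply_eq {P : Type*} [Group P] [Finite P]
    [Group.IsNilpotent P] (α : P ≃* P) {n : ℕ} (hα : ∀ x, α^[n] x = x)
    (hn : ∀ x : P, (orderOf x).Coprime n) (x : P) :
    ∃ y : P, (y⁻¹ * α y)⁻¹ * α (y⁻¹ * α y) = x⁻¹ * α x := by
  let f : P → P := fun x => x⁻¹ * α x
  have hinj : Set.InjOn f (Set.range f) := by
    rintro _ ⟨a, rfl⟩ _ ⟨b, rfl⟩ h
    refine mul_inv_eq_one.1 (Group.IsNilpotent.inv_mul_apply_eq_of_fixed P α n hα hn a b ?_)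
    change α (f a * (f b)⁻¹) = f a * (f b)⁻¹
    have h' : (f a)⁻¹ * α (f a) = (f b)⁻¹ * α (f b) := h
    rw [map_mul, map_inv, mul_inv_eq_iff_eq_mul, mul_assoc, ← h']
    group
  have hmaps : Set.MapsTo f (Set.range f) (Set.range f) := fun x _ => ⟨x, rfl⟩
  obtain ⟨⟨_, y, rfl⟩, hy⟩ :=
    Finite.surjective_of_injective (hmaps.restrict_inj.2 hinj) ⟨f x, x, rfl⟩
  replace hy := congrArg Subtype.val hy
  exact ⟨y, hy⟩

/-- Here α is conjugation by h on the π-part of K, where y⁻¹ * α y is the commutator of y and h. -/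
theorem exists_rightCommutator_rightCommutator_eq {Γ : Type*} [Group Γ] [Finite Γ] {π : Set ℕ}
    (K : Subgroup Γ) [K.Normal] [Group.IsNilpotent K] {x h : Γ} (hxK : x ∈ K)
    (hx : IsPiElement π x) (hh : IsPiElement πᶜ h) :
    ∃ y ∈ K, IsPiElement π y ∧
      rightCommutator (rightCommutator y h) h = rightCommutator x h := by
  have hP : Group.IsNilpotent (piSubgroup π K) :=
    Group.nilpotent_of_mulEquiv
      (Subgroup.subgroupOfEquivOfLe (fun x hx => hx.1 : piSubgroup π K ≤ K))
  let α : piSubgroup π K ≃* piSubgroup π K := MulAut.conjNormal h⁻¹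
  have hα (y : piSubgroup π K) : (α y : Γ) = h⁻¹ * y * h := by
    simp only [α, MulAut.conjNormal_apply, inv_inv]
  have hαn (m : ℕ) (y : piSubgroup π K) : (α^[m] y : Γ) = (h ^ m)⁻¹ * y * h ^ m := by
    induction m with
    | zero => simp
    | succ m ih =>
      rw [Function.iterate_succ_apply', hα, ih, pow_succ]
      group
  have hcomm (y : piSubgroup π K) : ((y⁻¹ * α y : piSubgroup π K) : Γ) =
      rightCommutator (y : Γ) h := by
    simp only [Subgroup.coe_mul, Subgroup.coe_inv, hα, rightCommutator, mul_assoc]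
  obtain ⟨y, hy⟩ := Group.IsNilpotent.exists_inv_mul_apply_eq α (n := orderOf h)
    (fun y => Subtype.ext (by rw [hαn, pow_orderOf_eq_one]; simp))
    (fun y => by
      rw [← Subgroup.orderOf_coe]
      exact y.2.2.coprime hh) ⟨x, hxK, hx⟩
  refine ⟨y, y.2.1, y.2.2, ?_⟩
  have := congrArg (Subtype.val) hy
  rwa [hcomm, hcomm, hcomm] at this

/-- Let a finite nilpotent group `R` act on a finite abelian group `A` generated by `p'`-elements
and by elements `x⁻¹ * x ^ a`, where `a` is a `p'`-element of `R`. Then no nontrivial `p`-element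
of `A` is fixed by all `p'`-elements of `R`. -/
theorem eq_one_of_fixed_of_generated {A R : Type*} [CommGroup A] [Finite A] [Group R] [Finite R]
    [Group.IsNilpotent R] (ρ : R →* MulAut A) {p : ℕ} (hp : p.Prime) {S : Set A}
    (hS : Subgroup.closure S = ⊤)
    (h : ∀ s ∈ S, IsPiElement {p}ᶜ s ∨ ∃ a, IsPiElement {p}ᶜ a ∧ ∃ x, s = x⁻¹ * ρ a x) {d : A}
    (hd : IsPiElement {p} d) (hfix : ∀ a, IsPiElement {p}ᶜ a → ρ a d = d) : d = 1 := by
  classical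
  let Q : Subgroup R :=
    { carrier := {a | IsPiElement {p}ᶜ a}
      one_mem' := IsPiElement.one
      mul_mem' := fun ha hb => IsPiElement.mul ha hb
      inv_mem' := fun ha => isPiElement_inv_iff.2 ha }
  have := Fintype.ofFinite Q
  -- The norm over the p'-elements of R kills each x⁻¹ * ρ a x and sends p'-elements to p'-elements,
  -- so its whole image consists of p'-elements. On the fixed element d it is the power |Q|, which
  -- is prime to p.
  let e : A →* A := ∏ a : Q, (ρ a : A ≃* A).toMonoidHom
  have he (x : A) : e x = ∏ a : Q, ρ a x := by
    simp [e]
  have hes : ∀ s ∈ S, IsPiElement {p}ᶜ (e s) := by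
    intro s hs
    rcases h s hs with h1 | ⟨b, hb, x, rfl⟩
    · exact h1.map e
    · have : e (ρ b x) = e x := by
        rw [he, he]
        refine Fintype.prod_equiv (Equiv.mulRight (⟨b, hb⟩ : Q)) _ _ fun a => ?_
        simp [map_mul, MulAut.mul_apply]
      rw [map_mul, map_inv, this, inv_mul_cancel]
      exact IsPiElement.one
  have hall (x : A) : IsPiElement {p}ᶜ (e x) := by
    have hx : x ∈ Subgroup.closure S := hS ▸ Subgroup.mem_top x
    induction hx using Subgroup.closure_induction with
    | mem s hs => exact hes s hs
    | one => rw [map_one]; exact IsPiElement.one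
    | mul x y _ _ hx hy => rw [map_mul]; exact hx.mul hy
    | inv x _ hx => rw [map_inv]; exact isPiElement_inv_iff.2 hx
  have hed : e d = d ^ Fintype.card Q := by
    rw [he, Finset.prod_congr rfl fun (a : Q) _ => hfix a a.2]
    simp
  have h1 : d ^ Fintype.card Q = 1 := (hd.pow _).eq_one (hed ▸ hall d)
  refine hd.eq_one (IsPiElement.of_pow (fun q hq hqd => ?_) h1)
  rw [Set.mem_compl_iff, Set.mem_singleton_iff]
  rintro rfl
  have : Fact q.Prime := ⟨hq⟩
  obtain ⟨a, ha⟩ := exists_prime_orderOf_dvd_card q hqd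
  have := a.2 q hq (by rw [Subgroup.orderOf_coe, ha])
  exact this rfl

end CoprimeAction

/-! ### Pro-π-elements and passage from finite quotients to G. -/

section Profinite

variable {G : Type*} [Group G] [TopologicalSpace G]

/-- An element of a profinite group is a pro-`π`-element if all primes dividing its order belong
to `π`. -/
def IsProPiElement (π : Set ℕ) (x : G) : Prop :=
  ∀ U : OpenNormalSubgroup G, IsPiElement π (QuotientGroup.mk x : G ⧸ U.toSubgroup)

theorem IsProPiElement.mono {π π' : Set ℕ} {x : G} (hx : IsProPiElement π x) (h : π ⊆ π') :
    IsProPiElement π' x := fun U => (hx U).mono h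

theorem IsProPiElement.conj {π : Set ℕ} {x : G} (hx : IsProPiElement π x) (g : G) :
    IsProPiElement π (g * x * g⁻¹) := fun U =>
  (hx U).conj (QuotientGroup.mk g : G ⧸ U.toSubgroup)

theorem IsProPiElement.one {π : Set ℕ} : IsProPiElement π (1 : G) := fun _ => IsPiElement.one

theorem IsProPiElement.coprime {π : Set ℕ} {x g : G} (hx : IsProPiElement π x)
    (hg : IsProPiElement πᶜ g) : (steinitzOrder x).Coprime (steinitzOrder g) := by
  intro p
  by_cases hp : (p : ℕ) ∈ π
  · right
    refine ENat.iSup_eq_zero.2 fun U => ?_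
    rw [Nat.cast_eq_zero]
    exact padicValNat.eq_zero_of_not_dvd fun h => hg U p p.2 h hp
  · left
    refine ENat.iSup_eq_zero.2 fun U => ?_
    rw [Nat.cast_eq_zero]
    exact padicValNat.eq_zero_of_not_dvd fun h => hp (hx U p p.2 h)

theorem mem_of_mem_closure_zpowers [IsTopologicalGroup G] {x : G} (N : Subgroup G)
    (hN : IsClosed (N : Set G)) (hx : x ∈ N) {y : G}
    (hy : y ∈ (Subgroup.zpowers x).topologicalClosure) : y ∈ N :=
  Subgroup.topologicalClosure_minimal _ (Subgroup.zpowers_le.2 hx) hN hy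

variable [IsTopologicalGroup G]

theorem isClosed_setOf_quotient (U : OpenNormalSubgroup G) (P : G ⧸ U.toSubgroup → Prop) :
    IsClosed {x : G | P (QuotientGroup.mk x)} := by
  have : DiscreteTopology (G ⧸ U.toSubgroup) := QuotientGroup.discreteTopology U.isOpen'
  exact (isClosed_discrete {y | P y}).preimage QuotientGroup.continuous_mk

theorem isClosed_setOf_isProPiElement (π : Set ℕ) : IsClosed {x : G | IsProPiElement π x} := by
  simp only [IsProPiElement, Set.ofPred_forall]
  exact isClosed_iInter fun U => isClosed_setOf_quotient U _

theorem mk_mem_zpowers_of_mem_closure (U : OpenNormalSubgroup G) {x y : G}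
    (hy : y ∈ (Subgroup.zpowers x).topologicalClosure) :
    (QuotientGroup.mk y : G ⧸ U.toSubgroup) ∈
      Subgroup.zpowers (QuotientGroup.mk x : G ⧸ U.toSubgroup) :=
  mem_of_mem_closure_zpowers
    ((Subgroup.zpowers (QuotientGroup.mk x : G ⧸ U.toSubgroup)).comap (QuotientGroup.mk' _))
    (isClosed_setOf_quotient U (· ∈ Subgroup.zpowers (QuotientGroup.mk x : G ⧸ U.toSubgroup)))
    (Subgroup.mem_zpowers _) hy

variable [CompactSpace G]

instance finite_quotient_openNormalSubgroup (U : OpenNormalSubgroup G) :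
    Finite (G ⧸ U.toSubgroup) :=
  Subgroup.quotient_finite_of_isOpen _ U.isOpen'

/-- Every element of a profinite group is the product of a pro-`π`-element and a
pro-`πᶜ`-element which are profinite powers of it. -/
theorem exists_proPi_mul (π : Set ℕ) (x : G) :
    ∃ a ∈ (Subgroup.zpowers x).topologicalClosure,
      ∃ b ∈ (Subgroup.zpowers x).topologicalClosure,
        IsProPiElement π a ∧ IsProPiElement πᶜ b ∧ x = a * b := by
  -- The candidates for the π-part of x modulo U. They form a directed family of nonempty compact
  -- sets, and any common point is the required a.
  let A (U : OpenNormalSubgroup G) : Set G :=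
    ((Subgroup.zpowers x).topologicalClosure : Set G) ∩
      ({a | IsPiElement π (QuotientGroup.mk a : G ⧸ U.toSubgroup)} ∩
      {a | IsPiElement πᶜ ((QuotientGroup.mk a : G ⧸ U.toSubgroup)⁻¹ * QuotientGroup.mk x)})
  have hclosed (U : OpenNormalSubgroup G) : IsClosed (A U) :=
    (Subgroup.isClosed_topologicalClosure _).inter
      ((isClosed_setOf_quotient U _).inter (isClosed_setOf_quotient U
        fun y => IsPiElement πᶜ (y⁻¹ * QuotientGroup.mk x)))
  have hmono {U V : OpenNormalSubgroup G} (h : U.toSubgroup ≤ V.toSubgroup) : A U ⊆ A V := by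
    rintro a ⟨h1, h2, h3⟩
    exact ⟨h1, h2.map (QuotientGroup.map U.toSubgroup V.toSubgroup (MonoidHom.id G) h),
      h3.map (QuotientGroup.map U.toSubgroup V.toSubgroup (MonoidHom.id G) h)⟩
  have : Nonempty (OpenNormalSubgroup G) :=
    ⟨{ toSubgroup := ⊤, isOpen' := isOpen_univ, isNormal' := inferInstance }⟩
  obtain ⟨a, ha⟩ := IsCompact.nonempty_iInter_of_directed_nonempty_isCompact_isClosed A
    (fun U V => ⟨U ⊓ V, hmono inf_le_left, hmono inf_le_right⟩)
    (fun U => by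
      obtain ⟨e, he, he'⟩ := exists_zpow_isPiElement π
        (isOfFinOrder_of_finite (QuotientGroup.mk x : G ⧸ U.toSubgroup))
      refine ⟨x ^ e, Subgroup.le_topologicalClosure _ ⟨e, rfl⟩, he, ?_⟩
      rwa [sub_eq_neg_add, zpow_add, zpow_one, zpow_neg] at he')
    (fun U => (hclosed U).isCompact) hclosed
  rw [Set.mem_iInter] at ha
  have ha' := (ha (Classical.arbitrary _)).1
  exact ⟨a, ha', a⁻¹ * x, mul_mem (inv_mem ha')
    (Subgroup.le_topologicalClosure _ (Subgroup.mem_zpowers x)), fun U => (ha U).2.1,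
    fun U => (ha U).2.2, (mul_inv_cancel_left a x).symm⟩

/-- The πᶜ-part of x is trivial modulo U, being a πᶜ-element and also a power of a π-element there.
-/
theorem exists_proPi_lift (π : Set ℕ) {U : OpenNormalSubgroup G} {x : G}
    (hx : IsPiElement π (QuotientGroup.mk x : G ⧸ U.toSubgroup)) :
    ∃ a ∈ (Subgroup.zpowers x).topologicalClosure, IsProPiElement π a ∧
      (QuotientGroup.mk a : G ⧸ U.toSubgroup) = QuotientGroup.mk x := by
  obtain ⟨a, ha, b, hb, haπ, hbπ, hab⟩ := exists_proPi_mul π x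
  refine ⟨a, ha, haπ, ?_⟩
  obtain ⟨n, hn⟩ := mk_mem_zpowers_of_mem_closure U hb
  have hb1 : (QuotientGroup.mk b : G ⧸ U.toSubgroup) = 1 :=
    IsPiElement.eq_one (hn ▸ hx.zpow n) (hbπ U)
  rw [hab, QuotientGroup.mk_mul, hb1, mul_one]

variable [TotallyDisconnectedSpace G]

theorem mem_of_forall_quotient {A : Set G} (hA : IsClosed A) {y : G}
    (h : ∀ U : OpenNormalSubgroup G, ∃ a ∈ A,
      (QuotientGroup.mk a : G ⧸ U.toSubgroup) = QuotientGroup.mk y) : y ∈ A := by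
  by_contra hy
  obtain ⟨U, hU⟩ := ProfiniteGrp.exist_openNormalSubgroup_sub_open_nhds_of_one
    (U := {u : G | y * u ∉ A}) (hA.isOpen_compl.preimage (continuous_const_mul y))
    (by simpa using hy)
  obtain ⟨a, ha, hay⟩ := h U
  have := hU (QuotientGroup.eq.1 hay.symm : y⁻¹ * a ∈ U.toSubgroup)
  simp [ha] at this

theorem eq_of_forall_quotient {x y : G} (h : ∀ U : OpenNormalSubgroup G,
    (QuotientGroup.mk x : G ⧸ U.toSubgroup) = QuotientGroup.mk y) : x = y :=
  Eq.symm <| mem_of_forall_quotient (A := {x}) isClosed_singleton fun U => ⟨x, rfl, h U⟩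

theorem eq_one_of_forall_quotient {x : G} (h : ∀ U : OpenNormalSubgroup G,
    (QuotientGroup.mk x : G ⧸ U.toSubgroup) = 1) : x = 1 :=
  eq_of_forall_quotient h

theorem commute_of_forall_quotient {x y : G} (h : ∀ U : OpenNormalSubgroup G,
    Commute (QuotientGroup.mk x : G ⧸ U.toSubgroup) (QuotientGroup.mk y)) : Commute x y :=
  eq_of_forall_quotient h

theorem IsProPiElement.eq_one {π : Set ℕ} {x : G} (hx : IsProPiElement π x)
    (hx' : IsProPiElement πᶜ x) : x = 1 :=
  eq_one_of_forall_quotient fun U => (hx U).eq_one (hx' U)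

/-- A closed normal subgroup is the intersection of the open normal subgroups containing it. -/
theorem mem_of_forall_openNormalSubgroup {N : Subgroup G} [N.Normal] (hN : IsClosed (N : Set G))
    {x : G} (h : ∀ U : OpenNormalSubgroup G, N ≤ U.toSubgroup → x ∈ U.toSubgroup) : x ∈ N := by
  refine mem_of_forall_quotient hN fun U => ?_
  obtain ⟨n, hn, u, hu, rfl⟩ := Subgroup.mem_sup_of_normal_left.1 (h
    { toSubgroup := N ⊔ U.toSubgroup
      isOpen' := Subgroup.isOpen_mono le_sup_right U.isOpen'
      isNormal' := inferInstance } le_sup_left)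
  exact ⟨n, hn, QuotientGroup.eq.2 (by simpa using hu)⟩

/-- A closed subgroup contains an element if it contains all its primary profinite powers. -/
theorem mem_of_primary_proPi_mem {T : Subgroup G} (hT : IsClosed (T : Set G)) {x : G}
    (h : ∀ q : ℕ, q.Prime → ∀ y ∈ (Subgroup.zpowers x).topologicalClosure,
      IsProPiElement {q} y → y ∈ T) : x ∈ T := by
  refine mem_of_forall_quotient hT fun U => ?_
  have : (QuotientGroup.mk x : G ⧸ U.toSubgroup) ∈ T.map (QuotientGroup.mk' U.toSubgroup) := by
    refine mem_of_primary_mem (isOfFinOrder_of_finite _) _ fun q hq m hm => ?_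
    obtain ⟨a, ha, haq, hax⟩ := exists_proPi_lift {q} (U := U) (x := x ^ m) hm
    refine ⟨a, h q hq a ?_ haq, hax⟩
    exact mem_of_mem_closure_zpowers _ (Subgroup.isClosed_topologicalClosure _)
      (Subgroup.le_topologicalClosure _ (Subgroup.npow_mem_zpowers x m)) ha
  exact this

end Profinite

/-! ### Pronilpotent subgroups with pronilpotent quotient. -/

section PronilpotentExtension

theorem rightCommutator_eq_inv_mul_conj {Γ : Type*} [Group Γ] (x h : Γ) :
    rightCommutator x h = x⁻¹ * (h⁻¹ * x * h⁻¹⁻¹) := by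
  rw [rightCommutator]; group

theorem rightCommutator_mem_of_mem {Γ : Type*} [Group Γ] {K : Subgroup Γ} [K.Normal] {x : Γ}
    (hx : x ∈ K) (h : Γ) : rightCommutator x h ∈ K := by
  rw [rightCommutator_eq_inv_mul_conj]
  exact mul_mem (inv_mem hx) (Subgroup.Normal.conj_mem inferInstance x hx h⁻¹)

variable {G : Type*} [Group G] [TopologicalSpace G]

/-- A closed subgroup which is pronilpotent, with pronilpotent quotient, expressed through the
finite quotients of the ambient profinite group. -/
structure IsPronilpotentExtension (K : Subgroup G) : Prop where
  isClosed : IsClosed (K : Set G)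
  isNilpotent_map (U : OpenNormalSubgroup G) :
    Group.IsNilpotent (K.map (QuotientGroup.mk' U.toSubgroup))
  isNilpotent_quotient (U : OpenNormalSubgroup G) (h : K ≤ U.toSubgroup) :
    Group.IsNilpotent (G ⧸ U.toSubgroup)

theorem IsPronilpotent.isNilpotent_map {N : Subgroup G} (h : IsPronilpotent N)
    (U : OpenNormalSubgroup G) : Group.IsNilpotent (N.map (QuotientGroup.mk' U.toSubgroup)) := by
  let V : OpenNormalSubgroup N :=
    { toSubgroup := U.toSubgroup.subgroupOf N
      isOpen' := U.isOpen'.preimage continuous_subtype_val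
      isNormal' := inferInstance }
  have := h V
  let f : N →* N.map (QuotientGroup.mk' U.toSubgroup) :=
    (QuotientGroup.mk' U.toSubgroup).subgroupMap N
  have hf : Function.Surjective f := MonoidHom.subgroupMap_surjective _ _
  have hker : V.toSubgroup ≤ f.ker := by
    intro x hx
    rw [MonoidHom.mem_ker]
    exact Subtype.ext ((QuotientGroup.eq_one_iff (x : G)).2 hx)
  refine Group.nilpotent_of_surjective (QuotientGroup.lift V.toSubgroup f hker) fun y => ?_
  obtain ⟨x, rfl⟩ := hf y
  exact ⟨QuotientGroup.mk x, rfl⟩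

theorem nilpotentResidual_normal : (nilpotentResidual G).Normal := by
  refine ⟨fun x hx g => ?_⟩
  rw [nilpotentResidual, Subgroup.mem_sInf] at hx ⊢
  exact fun N hN => hN.1.conj_mem x (hx N hN) g

variable [IsTopologicalGroup G] [CompactSpace G] [TotallyDisconnectedSpace G]

/-- The residual lies in any N witnessing meta-pronilpotence, so its images in finite quotients are
nilpotent as subgroups of the images of N. -/
theorem IsMetaPronilpotent.isPronilpotentExtension (hG : IsMetaPronilpotent G) :
    IsPronilpotentExtension (nilpotentResidual G) := by
  obtain ⟨N, hN, hNc, hNp, hNq⟩ := hG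
  obtain ⟨⟨hn, hc, hq⟩, hmin⟩ := isLeast_nilpotentResidual G
  have hle : nilpotentResidual G ≤ N := hmin ⟨hN, hNc, hNq⟩
  refine ⟨hc, fun U => ?_, (isPronilpotent_quotient_iff _).1 hq⟩
  have := hNp.isNilpotent_map U
  exact Group.nilpotent_of_mulEquiv
    (Subgroup.subgroupOfEquivOfLe (Subgroup.map_mono (f := QuotientGroup.mk' U.toSubgroup) hle))

end PronilpotentExtension

namespace IsPronilpotentExtension

variable {G : Type*} [Group G] [TopologicalSpace G] [IsTopologicalGroup G] [CompactSpace G]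

variable {K : Subgroup G} {π : Set ℕ}

theorem isProPiElement_mul (hK : IsPronilpotentExtension K) {x y : G} (hxK : x ∈ K)
    (hyK : y ∈ K) (hx : IsProPiElement π x) (hy : IsProPiElement π y) :
    IsProPiElement π (x * y) := by
  intro U
  have := hK.isNilpotent_map U
  exact ((piSubgroup π (K.map (QuotientGroup.mk' U.toSubgroup))).mul_mem
    ⟨⟨x, hxK, rfl⟩, hx U⟩ ⟨⟨y, hyK, rfl⟩, hy U⟩).2

theorem isProPiElement_rightCommutator [K.Normal] (hK : IsPronilpotentExtension K)
    {x : G} (hxK : x ∈ K)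
    (hx : IsProPiElement π x) (h : G) : IsProPiElement π (rightCommutator x h) := by
  rw [rightCommutator_eq_inv_mul_conj]
  exact hK.isProPiElement_mul (inv_mem hxK)
    (Subgroup.Normal.conj_mem inferInstance x hxK h⁻¹) (fun U => isPiElement_inv_iff.2 (hx U))
    (hx.conj h⁻¹)

variable [TotallyDisconnectedSpace G]

theorem commute (hK : IsPronilpotentExtension K) {x y : G} (hxK : x ∈ K) (hyK : y ∈ K)
    (hx : IsProPiElement π x) (hy : IsProPiElement πᶜ y) : Commute x y := by
  refine commute_of_forall_quotient fun U => ?_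
  have := hK.isNilpotent_map U
  let f := QuotientGroup.mk' U.toSubgroup
  have h1 : IsPiElement π (⟨f x, x, hxK, rfl⟩ : K.map f) :=
    (isPiElement_map_iff (K.map f).subtype_injective).1 (hx U)
  have h2 : IsPiElement πᶜ (⟨f y, y, hyK, rfl⟩ : K.map f) :=
    (isPiElement_map_iff (K.map f).subtype_injective).1 (hy U)
  exact (h1.commute h2).map (K.map f).subtype

variable [K.Normal]

theorem rightCommutator_mem (hK : IsPronilpotentExtension K) {s t : G}
    (hs : IsProPiElement π s) (ht : IsProPiElement πᶜ t) : rightCommutator s t ∈ K := by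
  refine mem_of_forall_openNormalSubgroup hK.isClosed fun U hU => ?_
  have := hK.isNilpotent_quotient U hU
  rw [← QuotientGroup.eq_one_iff]
  have h := ((hs U).commute (ht U)).eq
  simp only [rightCommutator, QuotientGroup.mk_mul, QuotientGroup.mk_inv, mul_assoc]
  rw [h]
  group

/-- The πᶜ-part of w vanishes in every finite quotient above K, hence lies in K. A π-element modulo
K can thus be corrected to a genuine one. -/
theorem exists_mul_mem (hK : IsPronilpotentExtension K) {w : G}
    (hw : ∀ U : OpenNormalSubgroup G, K ≤ U.toSubgroup →
      IsPiElement π (QuotientGroup.mk w : G ⧸ U.toSubgroup)) :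
    ∃ a ∈ (Subgroup.zpowers w).topologicalClosure, ∃ b ∈ K, IsProPiElement π a ∧ w = a * b := by
  obtain ⟨a, ha, b, hb, haπ, hbπ, hab⟩ := exists_proPi_mul π w
  refine ⟨a, ha, b, mem_of_forall_openNormalSubgroup hK.isClosed fun U hU => ?_, haπ, hab⟩
  obtain ⟨n, hn⟩ := mk_mem_zpowers_of_mem_closure U hb
  exact (QuotientGroup.eq_one_iff b).1 (IsPiElement.eq_one (hn ▸ (hw U hU).zpow n) (hbπ U))

/-- The finite case gives solutions modulo every open normal subgroup. The image of the compact set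
of pro-π-elements of K is closed, so an exact solution exists. -/
theorem exists_rightCommutator_rightCommutator_eq (hK : IsPronilpotentExtension K) {x h : G}
    (hxK : x ∈ K) (hx : IsProPiElement π x) (hh : IsProPiElement πᶜ h) :
    ∃ y ∈ K, IsProPiElement π y ∧
      rightCommutator (rightCommutator y h) h = rightCommutator x h := by
  let A : Set G := K ∩ {y | IsProPiElement π y}
  let f : G → G := fun y => rightCommutator (rightCommutator y h) h
  have hf : Continuous f := by
    unfold f rightCommutator
    fun_prop
  have hA : IsCompact A := (hK.isClosed.inter (isClosed_setOf_isProPiElement π)).isCompact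
  have hmem : rightCommutator x h ∈ f '' A := by
    refine mem_of_forall_quotient (hA.image hf).isClosed fun U => ?_
    have := hK.isNilpotent_map U
    have : (K.map (QuotientGroup.mk' U.toSubgroup)).Normal :=
      Subgroup.Normal.map inferInstance _ (QuotientGroup.mk'_surjective _)
    obtain ⟨_, ⟨y, hyK, rfl⟩, hy, hyx⟩ :=
      _root_.exists_rightCommutator_rightCommutator_eq (K.map (QuotientGroup.mk' U.toSubgroup))
        ⟨x, hxK, rfl⟩ (hx U) (hh U)
    obtain ⟨a, ha, haπ, hay⟩ := exists_proPi_lift π hy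
    refine ⟨f a, ⟨a, ⟨mem_of_mem_closure_zpowers K hK.isClosed hyK ha, haπ⟩, rfl⟩, ?_⟩
    refine Eq.trans ?_ hyx
    change rightCommutator (rightCommutator (QuotientGroup.mk a : G ⧸ U.toSubgroup)
      (QuotientGroup.mk h)) (QuotientGroup.mk h) = _
    rw [hay]
    rfl
  obtain ⟨y, hy, hyx⟩ := hmem
  exact ⟨y, hy.1, hy.2, hyx⟩

/-- In the induction step [x, h] = [[y, h], h], where [y, h] is already a value one level down and
is a pro-π-element, so its order is coprime to that of h. -/
theorem rightCommutator_mem_gammaStarValues (hK : IsPronilpotentExtension K) {k : ℕ}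
    (hk : 1 ≤ k) {x h : G} (hxK : x ∈ K) (hx : IsProPiElement π x) (hh : IsProPiElement πᶜ h) :
    rightCommutator x h ∈ gammaStarValues G k := by
  induction k, hk using Nat.le_induction generalizing x with
  | base => trivial
  | succ k hk ih =>
    obtain ⟨k, rfl⟩ := Nat.exists_eq_add_of_le' hk
    obtain ⟨y, hyK, hy, hyx⟩ := hK.exists_rightCommutator_rightCommutator_eq hxK hx hh
    exact ⟨rightCommutator y h, h, ⟨_, ih hyK hy, subset_closure (Subgroup.mem_zpowers _)⟩,
      (hK.isProPiElement_rightCommutator hyK hy h).coprime hh, hyx.symm⟩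

end IsPronilpotentExtension

/-! ### Continuous maps with fewer than continuum many values. -/

section Cantor

open Cardinal

/-- A nonempty compact Hausdorff space without isolated points has at least continuum many
points. -/
theorem two_power_aleph0_le_mk_of_perfect {X : Type*} [TopologicalSpace X] [CompactSpace X]
    [T2Space X] [Nonempty X] (h : ∀ x : X, ¬IsOpen ({x} : Set X)) : 2 ^ ℵ₀ ≤ #X := by
  let S := {O : Set X // IsOpen O ∧ O.Nonempty}
  have hstep (O : S) : ∃ P : Bool → S, (∀ b, closure (P b).1 ⊆ O.1) ∧
      Disjoint (closure (P false).1) (closure (P true).1) := by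
    obtain ⟨O, hO, x, hx⟩ := O
    obtain ⟨y, hy, hxy⟩ : ∃ y ∈ O, x ≠ y := by
      by_contra! hne
      have : O = {x} := Set.eq_singleton_iff_unique_mem.2 ⟨hx, fun y hy => (hne y hy).symm⟩
      exact h x (this ▸ hO)
    obtain ⟨u, hxu, hu, v, hyv, hv, huv⟩ := exists_open_nhds_disjoint_closure hxy
    obtain ⟨u', hxu', hu'c, hu'O⟩ := exists_mem_nhds_isClosed_subset (hO.mem_nhds hx)
    obtain ⟨v', hyv', hv'c, hv'O⟩ := exists_mem_nhds_isClosed_subset (hO.mem_nhds hy)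
    refine ⟨fun b => bif b then ⟨v ∩ interior v', hv.inter isOpen_interior, y, hyv,
        mem_interior_iff_mem_nhds.2 hyv'⟩
      else ⟨u ∩ interior u', hu.inter isOpen_interior, x, hxu,
        mem_interior_iff_mem_nhds.2 hxu'⟩, ?_, ?_⟩
    · rintro (_ | _)
      · exact (closure_minimal (Set.inter_subset_right.trans interior_subset) hu'c).trans hu'O
      · exact (closure_minimal (Set.inter_subset_right.trans interior_subset) hv'c).trans hv'O
    · exact huv.mono (closure_mono Set.inter_subset_left) (closure_mono Set.inter_subset_left)
  choose P hP hdisj using hstep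
  -- A Cantor scheme: the nested open sets along a branch σ. Branches separate at their first
  -- difference because sibling closures are disjoint.
  let D (σ : ℕ → Bool) (n : ℕ) : S :=
    n.rec ⟨Set.univ, isOpen_univ, Set.univ_nonempty⟩ fun n O => P O (σ n)
  have hD (σ : ℕ → Bool) (n : ℕ) : D σ (n + 1) = P (D σ n) (σ n) := rfl
  have hne (σ : ℕ → Bool) : (⋂ n, closure (D σ n).1).Nonempty :=
    IsCompact.nonempty_iInter_of_sequence_nonempty_isCompact_isClosed _
      (fun n => (hP _ _).trans subset_closure) (fun n => (D σ n).2.2.closure)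
      isClosed_closure.isCompact fun n => isClosed_closure
  choose p hp using hne
  have hp' (σ : ℕ → Bool) (n : ℕ) : p σ ∈ closure (D σ n).1 := Set.mem_iInter.1 (hp σ) n
  have hinj : Function.Injective p := by
    intro σ τ hστ
    have key (n : ℕ) (hn : D σ n = D τ n) : σ n = τ n := by
      have h1 := hp' σ (n + 1)
      have h2 := hp' τ (n + 1)
      rw [hD] at h1 h2
      rw [← hστ, ← hn] at h2
      rcases hs : σ n <;> rcases ht : τ n <;> rw [hs] at h1 <;> rw [ht] at h2
      · exact (Set.disjoint_left.1 (hdisj _) h1 h2).elim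
      · exact (Set.disjoint_left.1 (hdisj _) h2 h1).elim
    have hall (n : ℕ) : D σ n = D τ n := by
      induction n with
      | zero => rfl
      | succ n ih => rw [hD, hD, ih, key n ih]
    exact funext fun n => key n (hall n)
  have := lift_mk_le_lift_mk_of_injective hinj
  simpa using this

/-- A continuous map with fewer than continuum many values on a compact space is constant on some
nonempty open set. -/
theorem exists_isOpen_const_of_mk_lt {X Y : Type*} [TopologicalSpace X] [CompactSpace X]
    [Nonempty X] [TopologicalSpace Y] [T2Space Y] {f : X → Y} (hf : Continuous f)
    (h : #(Set.range f) < 2 ^ ℵ₀) : ∃ x, ∃ O : Set X, IsOpen O ∧ x ∈ O ∧ ∀ y ∈ O, f y = f x := by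
  have : CompactSpace (Set.range f) := isCompact_iff_compactSpace.1 (isCompact_range hf)
  obtain ⟨⟨_, x, rfl⟩, hx⟩ : ∃ z : Set.range f, IsOpen ({z} : Set (Set.range f)) := by
    by_contra! hne
    exact h.not_ge (two_power_aleph0_le_mk_of_perfect hne)
  refine ⟨x, _, hx.preimage hf.rangeFactorization, rfl, fun y hy => ?_⟩
  exact congrArg Subtype.val hy

end Cantor

/-! ### Centralization up to an open subgroup, for a fixed π. -/

section FewCommutators

open Cardinal

variable {G : Type*} [Group G] [TopologicalSpace G]

/-- The pro-`π`-elements of `K` in `W`. -/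
def proPiPart (K : Subgroup G) (π : Set ℕ) (W : OpenNormalSubgroup G) : Set G :=
  {u | u ∈ K ∧ IsProPiElement π u ∧ u ∈ W.toSubgroup}

theorem proPiPart_mono {K : Subgroup G} {π : Set ℕ} {W W' : OpenNormalSubgroup G} (h : W ≤ W') :
    proPiPart K π W ⊆ proPiPart K π W' := fun _ hu => ⟨hu.1, hu.2.1, h hu.2.2⟩

theorem conj_mem_proPiPart {K : Subgroup G} [K.Normal] {π : Set ℕ} {W : OpenNormalSubgroup G}
    {u : G} (hu : u ∈ proPiPart K π W) (g : G) :
    g * u * g⁻¹ ∈ proPiPart K π W :=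
  ⟨Subgroup.Normal.conj_mem inferInstance _ hu.1 g, hu.2.1.conj g,
    Subgroup.Normal.conj_mem inferInstance _ hu.2.2 g⟩

variable [IsTopologicalGroup G] [CompactSpace G] [TotallyDisconnectedSpace G]

/-- The commutator map on the compact space A × B has too few values to be nowhere locally constant;
W measures a neighbourhood of local constancy. -/
theorem exists_rightCommutator_const {A B V : Set G} (hA : IsClosed A) (hB : IsClosed B)
    (hA' : A.Nonempty) (hB' : B.Nonempty) (hV : #V < 2 ^ ℵ₀)
    (h : ∀ a ∈ A, ∀ b ∈ B, rightCommutator a b ∈ V) :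
    ∃ a ∈ A, ∃ b ∈ B, ∃ W : OpenNormalSubgroup G, ∀ a' ∈ A, ∀ b' ∈ B,
      a⁻¹ * a' ∈ W.toSubgroup → b⁻¹ * b' ∈ W.toSubgroup →
        rightCommutator a' b' = rightCommutator a b := by
  have := isCompact_iff_compactSpace.1 hA.isCompact
  have := isCompact_iff_compactSpace.1 hB.isCompact
  have := hA'.to_subtype
  have := hB'.to_subtype
  let f : A × B → G := fun x => rightCommutator x.1 x.2
  have hf : Continuous f := by
    unfold f rightCommutator
    fun_prop
  have hrange : Set.range f ⊆ V := by
    rintro _ ⟨x, rfl⟩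
    exact h _ x.1.2 _ x.2.2
  obtain ⟨⟨a, b⟩, O, hO, hab, hc⟩ :=
    exists_isOpen_const_of_mk_lt hf ((mk_le_mk_of_subset hrange).trans_lt hV)
  obtain ⟨u, v, hu, hv, hau, hbv, huv⟩ := isOpen_prod_iff.1 hO a b hab
  obtain ⟨u', hu', rfl⟩ := isOpen_induced_iff.1 hu
  obtain ⟨v', hv', rfl⟩ := isOpen_induced_iff.1 hv
  obtain ⟨W, hW⟩ := ProfiniteGrp.exist_openNormalSubgroup_sub_open_nhds_of_one
    (U := {w : G | (a : G) * w ∈ u'} ∩ {w : G | (b : G) * w ∈ v'})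
    ((hu'.preimage (continuous_const_mul _)).inter (hv'.preimage (continuous_const_mul _)))
    ⟨by simpa using hau, by simpa using hbv⟩
  refine ⟨a, a.2, b, b.2, W, fun a' ha' b' hb' haW hbW => ?_⟩
  have h1 : (a : G) * ((a : G)⁻¹ * a') ∈ u' := (hW haW).1
  have h2 : (b : G) * ((b : G)⁻¹ * b') ∈ v' := (hW hbW).2
  rw [mul_inv_cancel_left] at h1 h2
  exact hc (⟨a', ha'⟩, ⟨b', hb'⟩) (huv ⟨h1, h2⟩)

namespace IsPronilpotentExtension

variable {K : Subgroup G} {π : Set ℕ}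

/-- If `c` centralizes a normal subset of pro-`π`-elements of `K` and `k ∈ K`, then `c * k`
centralizes this subset as soon as it is a pro-`πᶜ`-element. -/
theorem commute_of_mul_mem (hK : IsPronilpotentExtension K) {T : Set G}
    (hT : ∀ u ∈ T, ∀ g, g * u * g⁻¹ ∈ T) (hTK : ∀ u ∈ T, u ∈ K ∧ IsProPiElement π u) {c k : G}
    (hk : k ∈ K) (hck : IsProPiElement πᶜ (c * k)) (hc : ∀ u ∈ T, Commute c u) :
    ∀ u ∈ T, Commute (c * k) u := by
  obtain ⟨a, ha, b, hb, haπ, hbπ, rfl⟩ := exists_proPi_mul π k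
  have hbK : b ∈ K := mem_of_mem_closure_zpowers K hK.isClosed hk hb
  set s := c * (a * b) with hs
  -- The πᶜ-part b of k centralizes T because the images of K are nilpotent, and c does by
  -- hypothesis. So s acts on T exactly as the π-element a does.
  have hconj (u : G) (hu : u ∈ T) : s * u * s⁻¹ = a * u * a⁻¹ := by
    have h1 : b * u * b⁻¹ = u := by
      rw [← (hK.commute (hTK u hu).1 hbK (hTK u hu).2 hbπ).eq, mul_inv_cancel_right]
    have h2 : c * (a * u * a⁻¹) * c⁻¹ = a * u * a⁻¹ := by
      rw [(hc _ (hT u hu a)).eq, mul_inv_cancel_right]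
    calc s * u * s⁻¹ = c * (a * (b * u * b⁻¹) * a⁻¹) * c⁻¹ := by rw [hs]; group
      _ = _ := by rw [h1, h2]
  have hpow (j : ℕ) (u : G) (hu : u ∈ T) : s ^ j * u * (s ^ j)⁻¹ = a ^ j * u * (a ^ j)⁻¹ := by
    induction j generalizing u with
    | zero => simp
    | succ j ih =>
      calc s ^ (j + 1) * u * (s ^ (j + 1))⁻¹ = s ^ j * (s * u * s⁻¹) * (s ^ j)⁻¹ := by
            rw [pow_succ]; group
        _ = a ^ j * (a * u * a⁻¹) * (a ^ j)⁻¹ := by rw [ih _ (hT u hu s), hconj u hu]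
        _ = _ := by rw [pow_succ]; group
  intro u hu
  refine commute_of_forall_quotient fun U => ?_
  -- Modulo U the orders of s and a are coprime. Choose j with s ^ j = s and a ^ j = 1 there, so
  -- that s acts trivially.
  obtain ⟨j, hj1, hj0⟩ := Nat.chineseRemainder ((haπ U).coprime (hck U)).symm 1 0
  have h := congrArg (QuotientGroup.mk : G → G ⧸ U.toSubgroup) (hpow j u hu)
  simp only [QuotientGroup.mk_mul, QuotientGroup.mk_inv, QuotientGroup.mk_pow] at h
  rw [pow_eq_pow_iff_modEq.2 hj1, pow_eq_pow_iff_modEq.2 hj0, pow_one, pow_zero, one_mul,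
    inv_one, mul_one, mul_inv_eq_iff_eq_mul] at h
  exact h

variable [K.Normal]

theorem commute_of_mul_mem_proPiPart (hK : IsPronilpotentExtension K) {W : OpenNormalSubgroup G}
    {s c k : G} (hs : IsProPiElement πᶜ s) (hsck : s = c * k) (hk : k ∈ K)
    (hc : ∀ u ∈ proPiPart K π W, Commute c u) : ∀ u ∈ proPiPart K π W, Commute s u := by
  subst hsck
  exact hK.commute_of_mul_mem (fun u hu g => conj_mem_proPiPart hu g)
    (fun u hu => ⟨hu.1, hu.2.1⟩) hk hs hc

/-- Constancy of [a * u, h] says that h and c = [a, h] conjugate each u in the same way. So h * c⁻¹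
centralizes these u, and the factor c ∈ K is absorbed by `commute_of_mul_mem_proPiPart`. -/
theorem commute_of_rightCommutator_const (hK : IsPronilpotentExtension K)
    {W : OpenNormalSubgroup G} {a h : G} (ha : a ∈ K) (hh : IsProPiElement πᶜ h)
    (hc : ∀ u ∈ proPiPart K π W, rightCommutator (a * u) h = rightCommutator a h) :
    ∀ u ∈ proPiPart K π W, Commute h u := by
  set c := rightCommutator a h with hcdef
  have hcK : c ∈ K := rightCommutator_mem_of_mem ha h
  refine hK.commute_of_mul_mem_proPiPart (c := h * c⁻¹) (k := c) hh (by group) hcK fun u hu => ?_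
  have h1 : u⁻¹ * c * (h⁻¹ * u * h) = c :=
    Eq.trans (by simp only [hcdef, rightCommutator]; group) (hc u hu)
  have h2 : h⁻¹ * u * h = c⁻¹ * u * c := by
    rw [mul_assoc, inv_mul_eq_iff_eq_mul] at h1
    rw [mul_assoc c⁻¹, ← h1, inv_mul_cancel_left]
  calc h * c⁻¹ * u = h * (c⁻¹ * u * c) * c⁻¹ := by group
    _ = u * (h * c⁻¹) := by rw [← h2]; group

variable {V : Set G}

/-- Every pro-`πᶜ`-element centralizes the pro-`π`-elements of `K` in some open subgroup. -/
theorem exists_commute_proPiPart (hK : IsPronilpotentExtension K) (hV : #V < 2 ^ ℵ₀)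
    (hKV : ∀ x ∈ K, IsProPiElement π x → ∀ h, IsProPiElement πᶜ h → rightCommutator x h ∈ V)
    {t : G} (ht : IsProPiElement πᶜ t) :
    ∃ W : OpenNormalSubgroup G, ∀ u ∈ proPiPart K π W, Commute t u := by
  obtain ⟨a, ⟨haK, ha⟩, _, rfl, W, hW⟩ := exists_rightCommutator_const
    (A := K ∩ {x | IsProPiElement π x}) (B := {t})
    (hK.isClosed.inter (isClosed_setOf_isProPiElement π)) isClosed_singleton
    ⟨1, one_mem _, IsProPiElement.one⟩ (Set.singleton_nonempty t) hV
    (fun a ha b hb => hKV a ha.1 ha.2 b (by rwa [Set.mem_singleton_iff.1 hb]))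
  exact ⟨W, hK.commute_of_rightCommutator_const haK ht fun u hu =>
    hW _ ⟨mul_mem haK hu.1, hK.isProPiElement_mul haK hu.1 ha hu.2.1⟩ _ rfl
      (by simpa using hu.2.2) (by simp)⟩

theorem exists_forall_mem_commute_proPiPart (hK : IsPronilpotentExtension K)
    (hV : #V < 2 ^ ℵ₀)
    (hKV : ∀ x ∈ K, IsProPiElement π x → ∀ h, IsProPiElement πᶜ h → rightCommutator x h ∈ V) :
    ∃ W : OpenNormalSubgroup G, ∀ w ∈ W.toSubgroup, IsProPiElement πᶜ w →
      ∀ u ∈ proPiPart K π W, Commute w u := by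
  obtain ⟨a, ⟨haK, ha⟩, h, hh, W, hW⟩ := exists_rightCommutator_const
    (A := K ∩ {x | IsProPiElement π x}) (B := {h | IsProPiElement πᶜ h})
    (hK.isClosed.inter (isClosed_setOf_isProPiElement π)) (isClosed_setOf_isProPiElement _)
    ⟨1, one_mem _, IsProPiElement.one⟩ ⟨1, IsProPiElement.one⟩ hV
    (fun a ha b hb => hKV a ha.1 ha.2 b hb)
  have key (h' : G) (hh' : IsProPiElement πᶜ h') (hW' : h⁻¹ * h' ∈ W.toSubgroup) :
      ∀ u ∈ proPiPart K π W, Commute h' u :=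
    hK.commute_of_rightCommutator_const haK hh' fun u hu =>
      (hW _ ⟨mul_mem haK hu.1, hK.isProPiElement_mul haK hu.1 ha hu.2.1⟩ _ hh'
        (by simpa using hu.2.2) hW').trans (hW _ ⟨haK, ha⟩ _ hh' (by simp) hW').symm
  refine ⟨W, fun w hw hwπ => ?_⟩
  -- The product h * w need not be a πᶜ-element, so it is replaced by its πᶜ-part h'. The error k
  -- lies in K and in W, since h * w is a πᶜ-element modulo each of them; thus h' stays in the coset
  -- of h.
  obtain ⟨h', hh', k, hk, hπ, hkπ, hwk⟩ := exists_proPi_mul πᶜ (h * w)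
  have hkU (U : OpenNormalSubgroup G)
      (hU : IsPiElement πᶜ (QuotientGroup.mk (h * w) : G ⧸ U.toSubgroup)) : k ∈ U.toSubgroup := by
    obtain ⟨n, hn⟩ := mk_mem_zpowers_of_mem_closure U hk
    exact (QuotientGroup.eq_one_iff k).1 (IsPiElement.eq_one (hn ▸ hU.zpow n) (hkπ U))
  have hkK : k ∈ K := mem_of_forall_openNormalSubgroup hK.isClosed fun U hU =>
    hkU U (by
      have := hK.isNilpotent_quotient U hU
      exact (hh U).mul (hwπ U))
  have hkW : k ∈ W.toSubgroup := hkU W (by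
    rw [QuotientGroup.mk_mul, (QuotientGroup.eq_one_iff w).2 hw, mul_one]
    exact hh W)
  have hh'W : h⁻¹ * h' ∈ W.toSubgroup := by
    have : h⁻¹ * h' = w * k⁻¹ := by
      rw [inv_mul_eq_iff_eq_mul, ← mul_assoc, hwk, mul_inv_cancel_right]
    rw [this]
    exact mul_mem hw (inv_mem hkW)
  refine hK.commute_of_mul_mem_proPiPart (c := h⁻¹ * h') (k := k) hwπ ?_ hkK fun u hu => ?_
  · rw [mul_assoc, ← hwk, inv_mul_cancel_left]
  · exact Commute.mul_left (key h hh (by simp) u hu).inv_left (key h' hπ hh'W u hu)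

/-- If there are fewer than continuum many commutators of pro-`π`-elements of `K` and
pro-`πᶜ`-elements, then all pro-`πᶜ`-elements centralize the pro-`π`-elements of `K` in some open
subgroup. -/
theorem exists_forall_commute_proPiPart (hK : IsPronilpotentExtension K)
    (hV : #V < 2 ^ ℵ₀)
    (hKV : ∀ x ∈ K, IsProPiElement π x → ∀ h, IsProPiElement πᶜ h → rightCommutator x h ∈ V) :
    ∃ N : OpenNormalSubgroup G, ∀ s, IsProPiElement πᶜ s →
      ∀ u ∈ proPiPart K π N, Commute s u := by
  obtain ⟨W, hW⟩ := hK.exists_forall_mem_commute_proPiPart hV hKV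
  have hrep (q : G ⧸ W.toSubgroup) : ∃ N : OpenNormalSubgroup G, N ≤ W ∧ ∀ s,
      IsProPiElement πᶜ s → QuotientGroup.mk s = q → ∃ t, IsProPiElement πᶜ t ∧
        QuotientGroup.mk t = q ∧ ∀ u ∈ proPiPart K π N, Commute t u := by
    by_cases h : ∃ t, IsProPiElement πᶜ t ∧ QuotientGroup.mk t = q
    · obtain ⟨t, ht, htq⟩ := h
      obtain ⟨N, hN⟩ := hK.exists_commute_proPiPart hV hKV ht
      exact ⟨W ⊓ N, inf_le_left, fun s _ _ => ⟨t, ht, htq, fun u hu =>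
        hN u (proPiPart_mono inf_le_right hu)⟩⟩
    · exact ⟨W, le_rfl, fun s hs hsq => (h ⟨s, hs, hsq⟩).elim⟩
  choose N hNW hN using hrep
  have : Nonempty (OpenNormalSubgroup G) := ⟨W⟩
  obtain ⟨M, hM⟩ := Finite.exists_ge N
  refine ⟨M, fun s hs => ?_⟩
  obtain ⟨t, ht, hts, htu⟩ := hN _ s hs rfl
  have hw : t⁻¹ * s ∈ W.toSubgroup := QuotientGroup.eq.1 hts
  -- Write s = t * w * b, with t the chosen representative of the coset of s, w a pro-πᶜ-element of
  -- W, and b ∈ K. Both t and w centralize, and b is absorbed.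
  obtain ⟨w, hw', b, hb, hwπ, hwb⟩ := hK.exists_mul_mem (π := πᶜ) (w := t⁻¹ * s) fun U hU => by
    have := hK.isNilpotent_quotient U hU
    exact (isPiElement_inv_iff.2 (ht U)).mul (hs U)
  have hwW : w ∈ W.toSubgroup :=
    mem_of_mem_closure_zpowers _ (Subgroup.isClosed_of_isOpen _ W.isOpen') hw hw'
  refine hK.commute_of_mul_mem_proPiPart (c := t * w) (k := b) hs ?_ hb fun u hu => ?_
  · rw [mul_assoc, ← hwb, mul_inv_cancel_left]
  · exact (htu u (proPiPart_mono (hM _) hu)).mul_left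
      (hW w hwW hwπ u (proPiPart_mono ((hM 1).trans (hNW 1)) hu))

end IsPronilpotentExtension

end FewCommutators

/-- An infinite fibre of q in B avoids its own value. If all fibres are finite, a maximal subset M
disjoint from its image is infinite: otherwise M, q(M) and the preimage of M would form a finite set
covering B. -/
theorem Set.Infinite.exists_subset_forall_apply_ne {α : Type*} {B : Set α} (hB : B.Infinite)
    {q : α → α} (hq : ∀ p ∈ B, q p ≠ p) :
    ∃ B' ⊆ B, B'.Infinite ∧ ∀ p ∈ B', ∀ p' ∈ B', q p ≠ p' := by
  by_cases h : ∃ r, {p ∈ B | q p = r}.Infinite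
  · obtain ⟨r, hr⟩ := h
    refine ⟨_, Set.sep_subset _ _, hr, ?_⟩
    rintro p ⟨_, hp⟩ p' ⟨hp'B, hp'⟩
    rw [hp, ← hp']
    exact hq p' hp'B
  · simp only [not_exists, Set.not_infinite] at h
    obtain ⟨M, hM⟩ := zorn_subset {C : Set α | C ⊆ B ∧ ∀ p ∈ C, ∀ p' ∈ C, q p ≠ p'} (by
      intro c hc hchain
      refine ⟨⋃₀ c, ⟨Set.sUnion_subset fun s hs => (hc hs).1, ?_⟩,
        fun s hs => Set.subset_sUnion_of_mem hs⟩
      rintro p ⟨s, hs, hps⟩ p' ⟨s', hs', hps'⟩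
      rcases hchain.total hs hs' with hle | hle
      · exact (hc hs').2 p (hle hps) p' hps'
      · exact (hc hs).2 p hps p' (hle hps'))
    refine ⟨M, hM.prop.1, fun hfin => hB ?_, hM.prop.2⟩
    refine ((hfin.union (hfin.image q)).union (hfin.biUnion fun r _ => h r)).subset fun p hp => ?_
    by_contra hpn
    simp only [Set.mem_union, Set.mem_image, Set.mem_iUnion, not_or, not_exists, not_and,
      Set.mem_ofPred_eq] at hpn
    obtain ⟨⟨hpM, hpq⟩, hqp⟩ := hpn
    refine hpM (hM.le_of_ge (y := insert p M) ⟨Set.insert_subset hp hM.prop.1, ?_⟩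
      (Set.subset_insert _ _) (Set.mem_insert _ _))
    rintro a (rfl | ha) b (rfl | hb)
    · exact hq _ hp
    · exact fun hab => hqp b hb hp hab
    · exact fun hab => hpq a ha hab
    · exact hM.prop.2 a ha b hb

theorem mem_of_isProPiElement_of_not_dvd {G : Type*} [Group G] [TopologicalSpace G]
    {N : OpenNormalSubgroup G} {p : ℕ}
    (hp : ¬p ∣ Nat.card (G ⧸ N.toSubgroup)) {u : G} (hu : IsProPiElement {p} u) :
    u ∈ N.toSubgroup := by
  rw [← QuotientGroup.eq_one_iff]
  refine (hu N).eq_one fun r _ hr hrp => hp ?_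
  rw [← Set.mem_singleton_iff.1 hrp]
  exact hr.trans (orderOf_dvd_natCard _)

/-! ### One open subgroup for all primes. -/

section FewCommutators

open Cardinal

variable {G : Type*} [Group G] [TopologicalSpace G] [IsTopologicalGroup G] [CompactSpace G]
  [TotallyDisconnectedSpace G]

theorem exists_primary_not_commute {p : ℕ} {s u : G} (hs : IsProPiElement {p}ᶜ s)
    (h : ¬Commute s u) : ∃ q, q ≠ p ∧ ∃ t, IsProPiElement {q} t ∧ ¬Commute t u := by
  by_contra! hne
  refine h ?_
  have hmem : s ∈ Subgroup.centralizer {u} := by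
    refine mem_of_primary_proPi_mem (Set.isClosed_centralizer {u}) fun q _ y hy hyq => ?_
    rw [Subgroup.mem_centralizer_singleton_iff]
    by_cases hqp : q = p
    · subst hqp
      have : IsProPiElement {q}ᶜ y := fun U => by
        obtain ⟨n, hn⟩ := mk_mem_zpowers_of_mem_closure U hy
        exact hn ▸ (hs U).zpow n
      rw [hyq.eq_one this, one_mul, mul_one]
    · exact hne q hqp y hyq
  exact Subgroup.mem_centralizer_singleton_iff.1 hmem

namespace IsPronilpotentExtension

variable {K : Subgroup G} [K.Normal] {V : Set G}

/-- If there are fewer than continuum many coprime commutators of elements of `K` and elements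
of `G`, then for some open normal subgroup `N` and all primes `p` the `p`-elements of `K ⊓ N` are
centralized by all `p'`-elements. -/
theorem exists_forall_prime_commute (hK : IsPronilpotentExtension K) (hV : #V < 2 ^ ℵ₀)
    (hKV : ∀ π, ∀ x ∈ K, IsProPiElement π x → ∀ h, IsProPiElement πᶜ h →
      rightCommutator x h ∈ V) :
    ∃ N : OpenNormalSubgroup G, ∀ p : ℕ, ∀ s, IsProPiElement {p}ᶜ s →
      ∀ u ∈ proPiPart K {p} N, Commute s u := by
  let B : Set ℕ := {p | ∃ u ∈ K, IsProPiElement {p} u ∧ ∃ s, IsProPiElement {p}ᶜ s ∧ ¬Commute s u}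
  have hBq (p : ℕ) : ∃ q, p ∈ B → q ≠ p ∧ ∃ u ∈ K, IsProPiElement {p} u ∧
      ∃ s, IsProPiElement {q} s ∧ ¬Commute s u := by
    by_cases hp : p ∈ B
    · obtain ⟨u, huK, hu, s, hs, hsu⟩ := hp
      obtain ⟨q, hqp, t, ht, htu⟩ := exists_primary_not_commute hs hsu
      exact ⟨q, fun _ => ⟨hqp, u, huK, hu, t, ht, htu⟩⟩
    · exact ⟨0, fun h => (hp h).elim⟩
  choose q hq using hBq
  have hB : B.Finite := by
    by_contra hinf
    -- Apply the fixed-π result to π = B', which contains no q p with p ∈ B'. A p ∈ B' exceeding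
    -- |G/N| has all its p-elements inside N, so they commute with all q p-elements, a
    -- contradiction.
    obtain ⟨B', hB'B, hB', hqB'⟩ :=
      Set.Infinite.exists_subset_forall_apply_ne hinf fun p hp => (hq p hp).1
    obtain ⟨N, hN⟩ := hK.exists_forall_commute_proPiPart hV (hKV B')
    obtain ⟨p, hp, hpN⟩ := hB'.exists_gt (Nat.card (G ⧸ N.toSubgroup))
    obtain ⟨u, huK, hu, s, hs, hsu⟩ := (hq p (hB'B hp)).2
    refine hsu (hN s (hs.mono ?_) u ⟨huK, hu.mono (by simpa using hp), ?_⟩)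
    · exact Set.singleton_subset_iff.2 fun hqp => hqB' p hp _ hqp rfl
    · exact mem_of_isProPiElement_of_not_dvd
        (fun hd => (Nat.le_of_dvd Nat.card_pos hd).not_gt hpN) hu
  choose N hN using fun p : ℕ => hK.exists_forall_commute_proPiPart (π := {p}) hV (hKV {p})
  have := hB.to_subtype
  have : Nonempty (OpenNormalSubgroup G) := ⟨N 0⟩
  obtain ⟨M, hM⟩ := Finite.exists_ge fun p : B => N p
  refine ⟨M, fun p s hs u hu => ?_⟩
  by_cases hp : p ∈ B
  · exact hN p s hs u (proPiPart_mono (hM ⟨p, hp⟩) hu)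
  · by_contra hsu
    exact hp ⟨u, hu.1, hu.2.1, s, hs, hsu⟩

end IsPronilpotentExtension

end FewCommutators

/-! ### Generation of K by coprime commutators, and finiteness. -/

section CoprimeCommutators

open scoped commutatorElement

variable {G : Type*} [Group G] [TopologicalSpace G]

/-- The commutators `[x, h]`, where `x ∈ K` and `h` have coprime orders. -/
def coprimeCommutators (K : Subgroup G) : Set G :=
  {c | ∃ (π : Set ℕ) (x h : G), x ∈ K ∧ IsProPiElement π x ∧ IsProPiElement πᶜ h ∧
    c = rightCommutator x h}

instance closure_coprimeCommutators_normal (K : Subgroup G) [K.Normal] :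
    (Subgroup.closure (coprimeCommutators K)).Normal := by
  refine ⟨fun c hc g => ?_⟩
  have hle : Subgroup.closure (coprimeCommutators K) ≤
      (Subgroup.closure (coprimeCommutators K)).comap (MulAut.conj g).toMonoidHom := by
    refine (Subgroup.closure_le _).2 ?_
    rintro _ ⟨π, x, h, hxK, hx, hh, rfl⟩
    refine Subgroup.subset_closure ⟨π, g * x * g⁻¹, g * h * g⁻¹,
      Subgroup.Normal.conj_mem inferInstance x hxK g, hx.conj g, hh.conj g, ?_⟩
    simp only [rightCommutator, MulEquiv.coe_toMonoidHom, MulAut.conj_apply]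
    group
  exact hle hc

theorem finite_commutatorSet_of_finiteIndex_center (Γ : Type*) [Group Γ]
    [(Subgroup.center Γ).FiniteIndex] : Finite (commutatorSet Γ) := by
  let r : Γ ⧸ Subgroup.center Γ → Γ := Quotient.out
  refine ((Set.finite_range fun x : (Γ ⧸ Subgroup.center Γ) × (Γ ⧸ Subgroup.center Γ) =>
    ⁅r x.1, r x.2⁆).subset ?_).to_subtype
  rintro _ ⟨x, y, rfl⟩
  refine ⟨(x, y), ?_⟩
  obtain ⟨z, hz⟩ := QuotientGroup.mk_out_eq_mul (Subgroup.center Γ) x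
  obtain ⟨w, hw⟩ := QuotientGroup.mk_out_eq_mul (Subgroup.center Γ) y
  change ⁅(x : Γ ⧸ Subgroup.center Γ).out, (y : Γ ⧸ Subgroup.center Γ).out⁆ = ⁅x, y⁆
  rw [hz, hw]
  have hz' (g : Γ) : (z : Γ) * g = g * z := (Subgroup.mem_center_iff.1 z.2 g).symm
  have hw' (g : Γ) : (w : Γ) * g = g * w := (Subgroup.mem_center_iff.1 w.2 g).symm
  calc ⁅x * z, y * (w : Γ)⁆ = x * ((z : Γ) * (y * w)) * ((z : Γ)⁻¹ * x⁻¹) * ((w : Γ)⁻¹ * y⁻¹) := by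
        simp only [commutatorElement_def, mul_inv_rev, mul_assoc]
    _ = x * y * ((w : Γ) * x⁻¹) * ((w : Γ)⁻¹ * y⁻¹) := by rw [hz']; group
    _ = ⁅x, y⁆ := by rw [hw', commutatorElement_def]; group

variable [IsTopologicalGroup G] [CompactSpace G] [TotallyDisconnectedSpace G]

/-- The open normal subgroup generated by a normal subgroup and an open normal subgroup. -/
def OpenNormalSubgroup.supNormal (U : OpenNormalSubgroup G) (N : Subgroup G) [N.Normal] :
    OpenNormalSubgroup G where
  toSubgroup := N ⊔ U.toSubgroup
  isOpen' := Subgroup.isOpen_mono le_sup_right U.isOpen'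
  isNormal' := inferInstance

namespace IsPronilpotentExtension

variable {K : Subgroup G} [K.Normal]

/-- Coprime elements of the finite quotient lift to G, which verifies both hypotheses of
`isNilpotent_of_coprime_commute` for the image of K. -/
theorem isNilpotent_quotient_of_coprimeCommutators_subset (hK : IsPronilpotentExtension K)
    {U : OpenNormalSubgroup G} (hU : coprimeCommutators K ⊆ U.toSubgroup) :
    Group.IsNilpotent (G ⧸ U.toSubgroup) := by
  have := hK.isNilpotent_map U
  have : (K.map (QuotientGroup.mk' U.toSubgroup)).Normal :=
    Subgroup.Normal.map inferInstance _ (QuotientGroup.mk'_surjective _)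
  have hlift (π : Set ℕ) (x : G ⧸ U.toSubgroup) (hx : IsPiElement π x) :
      ∃ a, IsProPiElement π a ∧ (QuotientGroup.mk a : G ⧸ U.toSubgroup) = x := by
    obtain ⟨x, rfl⟩ := QuotientGroup.mk_surjective x
    obtain ⟨a, _, haπ, hax⟩ := exists_proPi_lift π hx
    exact ⟨a, haπ, hax⟩
  refine isNilpotent_of_coprime_commute (K.map (QuotientGroup.mk' U.toSubgroup)) ?_ ?_
  · rintro π _ h ⟨x, hxK, rfl⟩ hx hh
    obtain ⟨a, ha, haπ, hax⟩ := exists_proPi_lift π hx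
    obtain ⟨b, hbπ, rfl⟩ := hlift _ h hh
    have hc : rightCommutator a b ∈ U.toSubgroup :=
      hU ⟨π, a, b, mem_of_mem_closure_zpowers K hK.isClosed hxK ha, haπ, hbπ, rfl⟩
    rw [← QuotientGroup.eq_one_iff] at hc
    change rightCommutator (QuotientGroup.mk a : G ⧸ U.toSubgroup) (QuotientGroup.mk b) = 1 at hc
    rw [hax, rightCommutator, mul_assoc, ← mul_inv_rev, inv_mul_eq_one] at hc
    exact hc.symm
  · intro π x h hx hh
    obtain ⟨a, haπ, rfl⟩ := hlift _ x hx
    obtain ⟨b, hbπ, rfl⟩ := hlift _ h hh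
    exact ⟨_, hK.rightCommutator_mem haπ hbπ, rfl⟩

/-- Density of the subgroup L generated by the coprime commutators: the quotient by L M is
nilpotent, so minimality of K puts K inside L M. -/
theorem exists_mem_closure_coprimeCommutators (hK : IsPronilpotentExtension K)
    (hmin : ∀ U : OpenNormalSubgroup G, Group.IsNilpotent (G ⧸ U.toSubgroup) →
      K ≤ U.toSubgroup) (M : OpenNormalSubgroup G) {x : G} (hx : x ∈ K) :
    ∃ l ∈ Subgroup.closure (coprimeCommutators K),
      (QuotientGroup.mk l : G ⧸ M.toSubgroup) = QuotientGroup.mk x := by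
  have h := hmin (M.supNormal (Subgroup.closure (coprimeCommutators K)))
    (hK.isNilpotent_quotient_of_coprimeCommutators_subset
      (Subgroup.subset_closure.trans (le_sup_left : _ ≤ _ ⊔ M.toSubgroup)))
  obtain ⟨l, hl, m, hm, rfl⟩ := Subgroup.mem_sup_of_normal_left.1 (h hx)
  exact ⟨l, hl, QuotientGroup.eq.2 (by simpa using hm)⟩

/-- If the `p`-elements of `K ⊓ N` are centralized by all `p'`-elements, for all primes `p`, then
`K ⊓ N` is contained in the centre of `K`. -/
theorem inf_le_centralizer (hK : IsPronilpotentExtension K)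
    (hmin : ∀ U : OpenNormalSubgroup G, Group.IsNilpotent (G ⧸ U.toSubgroup) →
      K ≤ U.toSubgroup) {N : OpenNormalSubgroup G}
    (hN : ∀ p : ℕ, ∀ s, IsProPiElement {p}ᶜ s → ∀ u ∈ proPiPart K {p} N, Commute s u) :
    K ⊓ N.toSubgroup ≤ Subgroup.centralizer K := by
  intro d hd
  refine mem_of_primary_proPi_mem (Set.isClosed_centralizer _) fun q _ y hy hyq => ?_
  have hyK : y ∈ K := mem_of_mem_closure_zpowers K hK.isClosed hd.1 hy
  have hyN : y ∈ proPiPart K {q} N := ⟨hyK, hyq,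
    mem_of_mem_closure_zpowers _ (Subgroup.isClosed_of_isOpen _ N.isOpen') hd.2 hy⟩
  have hle : Subgroup.closure (coprimeCommutators K) ≤ Subgroup.centralizer {y} := by
    refine (Subgroup.closure_le _).2 ?_
    rintro _ ⟨π, x, h, hxK, hx, hh, rfl⟩
    rw [SetLike.mem_coe, Subgroup.mem_centralizer_singleton_iff]
    -- If q ∈ π, then h is a q'-element and commutes with both y and x * y * x⁻¹. Otherwise [x, h]
    -- and y are elements of coprime orders in the pronilpotent group K.
    by_cases hq : q ∈ π
    · have hh' : IsProPiElement {q}ᶜ h :=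
        hh.mono (Set.compl_subset_compl.2 (Set.singleton_subset_iff.2 hq))
      have h1 := (hN q h hh' _ (conj_mem_proPiPart hyN x)).inv_left.eq
      calc rightCommutator x h * y = x⁻¹ * h⁻¹ * x * (h * y) := by
            rw [rightCommutator]; group
        _ = x⁻¹ * (h⁻¹ * (x * y * x⁻¹)) * x * h := by rw [(hN q h hh' y hyN).eq]; group
        _ = y * rightCommutator x h := by rw [h1, rightCommutator]; group
    · exact (hK.commute (rightCommutator_mem_of_mem hxK h) hyK
        (hK.isProPiElement_rightCommutator hxK hx h)
        (hyq.mono (Set.singleton_subset_iff.2 hq))).eq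
  rw [Subgroup.mem_centralizer_iff]
  refine fun x hx => (commute_of_forall_quotient fun M => ?_ : Commute x y)
  obtain ⟨l, hl, hlx⟩ := hK.exists_mem_closure_coprimeCommutators hmin M hx
  rw [← hlx]
  exact congrArg (QuotientGroup.mk : G → G ⧸ M.toSubgroup)
    (Subgroup.mem_centralizer_singleton_iff.1 (hle hl))

/-- The nilpotent group G/KM acts on the abelian group KM/M, which is generated by images of coprime
commutators [x, h]. Such an image is a p'-element if p ∉ π; otherwise it arises from the action of
the p'-element h. So `eq_one_of_fixed_of_generated` kills the image of y. -/
theorem mem_of_commutator_le (hK : IsPronilpotentExtension K)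
    (hmin : ∀ U : OpenNormalSubgroup G, Group.IsNilpotent (G ⧸ U.toSubgroup) →
      K ≤ U.toSubgroup) {M : OpenNormalSubgroup G} (hM : ⁅K, K⁆ ≤ M.toSubgroup) {p : ℕ}
    (hp : p.Prime) {y : G} (hyK : y ∈ K) (hy : IsProPiElement {p} y)
    (hcomm : ∀ s, IsProPiElement {p}ᶜ s → Commute s y) : y ∈ M.toSubgroup := by
  let f := QuotientGroup.mk' M.toSubgroup
  let A := K.map f
  have hAn : A.Normal := Subgroup.Normal.map inferInstance _ (QuotientGroup.mk'_surjective _)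
  have hA (a b : A) : a * b = b * a := by
    obtain ⟨_, x, hx, rfl⟩ := a
    obtain ⟨_, z, hz, rfl⟩ := b
    refine Subtype.ext ?_
    change f x * f z = f z * f x
    have h1 : f ⁅x, z⁆ = 1 := (QuotientGroup.eq_one_iff _).2
      (hM (Subgroup.commutator_mem_commutator hx hz))
    rwa [map_commutatorElement, commutatorElement_eq_one_iff_mul_comm] at h1
  let _ : CommGroup A := { (inferInstance : Group A) with mul_comm := hA }
  let W := M.supNormal K
  have hRnil : Group.IsNilpotent (G ⧸ W.toSubgroup) :=
    hK.isNilpotent_quotient W (le_sup_left : K ≤ K ⊔ M.toSubgroup)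
  let φ : G →* MulAut A := MulAut.conjNormal.comp f
  have hφ (g : G) (a : A) : (φ g a : G ⧸ M.toSubgroup) = f g * a * (f g)⁻¹ :=
    MulAut.conjNormal_apply _ _
  have hker : W.toSubgroup ≤ φ.ker := by
    refine sup_le (fun x hx => ?_) fun x hx => ?_
    · refine MulEquiv.ext fun a => Subtype.ext ?_
      have : f x * a = a * f x := congrArg Subtype.val (hA ⟨f x, x, hx, rfl⟩ a)
      rw [hφ, this, mul_inv_cancel_right]
      rfl
    · rw [MonoidHom.mem_ker]
      change MulAut.conjNormal (f x) = 1
      rw [show f x = 1 from (QuotientGroup.eq_one_iff x).2 hx, map_one]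
  let ρ : G ⧸ W.toSubgroup →* MulAut A := QuotientGroup.lift W.toSubgroup φ hker
  have hρ (g : G) : ρ (QuotientGroup.mk g) = φ g := rfl
  let S : Set A := {a | ∃ c ∈ coprimeCommutators K, (a : G ⧸ M.toSubgroup) = f c}
  have hS : Subgroup.closure S = ⊤ := by
    refine (Subgroup.eq_top_iff' _).2 ?_
    rintro ⟨_, x, hx, rfl⟩
    obtain ⟨l, hl, hlx⟩ := hK.exists_mem_closure_coprimeCommutators hmin M hx
    have hmem : f l ∈ (Subgroup.closure S).map A.subtype := by
      rw [MonoidHom.map_closure]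
      have : f l ∈ (Subgroup.closure (coprimeCommutators K)).map f := ⟨l, hl, rfl⟩
      rw [MonoidHom.map_closure] at this
      refine Subgroup.closure_mono ?_ this
      rintro _ ⟨c, hc, rfl⟩
      obtain ⟨π, z, h, hzK, -, -, rfl⟩ := id hc
      exact ⟨⟨_, _, rightCommutator_mem_of_mem hzK h, rfl⟩, ⟨_, hc, rfl⟩, rfl⟩
    obtain ⟨a, ha, hal⟩ := hmem
    have : a = ⟨f x, x, hx, rfl⟩ := Subtype.ext (hal.trans hlx)
    exact this ▸ ha
  have hone := eq_one_of_fixed_of_generated ρ hp hS ?_ (d := ⟨f y, y, hyK, rfl⟩) ?_ ?_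
  · exact (QuotientGroup.eq_one_iff y).1 (congrArg Subtype.val hone)
  · rintro a ⟨_, ⟨π, x, h, hxK, hx, hh, rfl⟩, hac⟩
    by_cases hpπ : p ∈ π
    · right
      refine ⟨QuotientGroup.mk h⁻¹, isPiElement_inv_iff.2 ((hh W).mono
        (Set.compl_subset_compl.2 (Set.singleton_subset_iff.2 hpπ))), ⟨f x, x, hxK, rfl⟩, ?_⟩
      refine Subtype.ext ?_
      rw [hac, hρ, Subgroup.coe_mul, hφ, rightCommutator_eq_inv_mul_conj]
      simp
    · left
      refine (isPiElement_map_iff A.subtype_injective).1 ?_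
      rw [Subgroup.subtype_apply, hac]
      exact (hK.isProPiElement_rightCommutator hxK hx h M).mono
        (by simpa using hpπ)
  · exact (isPiElement_map_iff A.subtype_injective).1 (hy M)
  · intro a ha
    obtain ⟨g, rfl⟩ := QuotientGroup.mk_surjective a
    obtain ⟨s, _, hs, hsg⟩ := exists_proPi_lift _ ha
    rw [← hsg, hρ]
    refine Subtype.ext ?_
    rw [hφ]
    change f s * f y * (f s)⁻¹ = f y
    rw [← map_mul, (hcomm s hs).eq, map_mul, mul_inv_cancel_right]

/-- K ∩ N is central of finite index in K, so [K, K] is finite by Schur, hence closed. The primary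
parts of elements of K ∩ N lie in every open normal subgroup above [K, K], so K ∩ N ≤ [K, K]. -/
theorem finite_of_forall_prime_commute (hK : IsPronilpotentExtension K)
    (hmin : ∀ U : OpenNormalSubgroup G, Group.IsNilpotent (G ⧸ U.toSubgroup) →
      K ≤ U.toSubgroup) {N : OpenNormalSubgroup G}
    (hN : ∀ p : ℕ, ∀ s, IsProPiElement {p}ᶜ s → ∀ u ∈ proPiPart K {p} N, Commute s u) :
    (K : Set G).Finite := by
  have hcent := hK.inf_le_centralizer hmin hN
  have hNfin : N.toSubgroup.FiniteIndex := Subgroup.finiteIndex_of_finite_quotient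
  have hle : N.toSubgroup.subgroupOf K ≤ Subgroup.center K := by
    intro x hx
    rw [Subgroup.mem_center_iff]
    intro z
    exact Subtype.ext (Subgroup.mem_centralizer_iff.1 (hcent ⟨x.2, hx⟩) z z.2)
  have : (Subgroup.center K).FiniteIndex := Subgroup.finiteIndex_of_le hle
  have := finite_commutatorSet_of_finiteIndex_center K
  have hfin : ((⁅K, K⁆ : Subgroup G) : Set G).Finite := by
    rw [← Subgroup.map_subtype_commutator]
    have : Finite (commutator K) := inferInstance
    exact (Set.finite_coe_iff.1 this).image _
  have hDfin : ((K ⊓ N.toSubgroup : Subgroup G) : Set G).Finite := by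
    refine hfin.subset fun d hd => ?_
    refine mem_of_primary_proPi_mem hfin.isClosed fun p hp y hy hyp => ?_
    have hyK : y ∈ K := mem_of_mem_closure_zpowers K hK.isClosed hd.1 hy
    have hyN : y ∈ proPiPart K {p} N := ⟨hyK, hyp,
      mem_of_mem_closure_zpowers _ (Subgroup.isClosed_of_isOpen _ N.isOpen') hd.2 hy⟩
    exact mem_of_forall_openNormalSubgroup hfin.isClosed fun M hM =>
      hK.mem_of_commutator_le hmin hM hp hyK hyp fun s hs => hN p s hs y hyN
  refine Set.Finite.of_finite_fibers (QuotientGroup.mk : G → G ⧸ N.toSubgroup)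
    (Set.toFinite _) ?_
  rintro _ ⟨x, hx, rfl⟩
  refine (hDfin.image (x * ·)).subset ?_
  rintro z ⟨hz, hzx⟩
  exact ⟨x⁻¹ * z, ⟨K.mul_mem (K.inv_mem hx) hz, QuotientGroup.eq.1 hzx.symm⟩,
    mul_inv_cancel_left x z⟩

end IsPronilpotentExtension

end CoprimeCommutators

theorem mainTheorem5 (G : Type*) [Group G] [TopologicalSpace G] [IsTopologicalGroup G]
    [CompactSpace G] [TotallyDisconnectedSpace G] (hG : IsMetaPronilpotent G)
    (k : ℕ) (hk : 1 ≤ k)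
    (hcard : Cardinal.mk (gammaStarValues G k) < 2 ^ Cardinal.aleph0) :
    (nilpotentResidual G : Set G).Finite := by
  have hn : (nilpotentResidual G).Normal := nilpotentResidual_normal
  have hK := hG.isPronilpotentExtension
  obtain ⟨N, hN⟩ := hK.exists_forall_prime_commute hcard fun π x hxK hx h hh =>
    hK.rightCommutator_mem_gammaStarValues hk hxK hx hh
  refine hK.finite_of_forall_prime_commute (fun U hU => ?_) hN
  refine (isLeast_nilpotentResidual G).2 ⟨inferInstance, Subgroup.isClosed_of_isOpen _ U.isOpen',
    (isPronilpotent_quotient_iff _).2 fun W hW => ?_⟩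
  exact Group.nilpotent_of_surjective (QuotientGroup.map U.toSubgroup W.toSubgroup
    (MonoidHom.id G) hW) (QuotientGroup.map_surjective_of_surjective _ _ _
      (QuotientGroup.mk_surjective) _)
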